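/- Conventions. A simplicial category is a category enriched over simplicial sets whose ordinary morphisms are the vertices of the simplicial hom-sets $\mathrm{Map}(X,Y)$. A simplicial model category is a model category (with at least finite limits and colimits) that is also a simplicial category, has powers and copowers by all simplicial sets, and satisfies Quillen's axiom SM7. For a natural transformation $\alpha:S\to T$ between functors of model categories and a map $i:A\to B$, the Leibniz application $\alpha\,\widehat{@}\,i$ is the induced map $SB\amalg_{SA}TA\to TB$; $\alpha$ is a Quillen cofibration if, for every cofibration $i$, the map $\alpha\,\widehat{@}\,i$ is a cofibration that is acyclic if $i$ is. A monad is Quillen unit-cofibrant if its unit $\mathrm{Id}\to T$ is a Quillen cofibration. For a functor $U:\mathcal M\to\mathcal N$ into a model category, a morphism $f$ of $\mathcal M$ is a $U$-cofibration, $U$-fibration or $U$-weak equivalence ($U$-acyclic) if $Uf$ is a cofibration, fibration or weak equivalence in $\mathcal N$; it is a projective cofibration if it has the left lifting property for all $U$-acyclic $U$-fibrations, and a projective acyclic cofibration if it has the left lifting property for all $U$-fibrations. For an adjunction $F\dashv U$ with $F:\mathcal N\to\mathcal M$ and an object $Z$ of $\mathcal M$, $\mathsf B_\bullet(F,UF,UZ)$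 is the simplicial object of $\mathcal M$ with $\mathsf B_n(F,UF,UZ)=F(UF)^nUZ=(FU)^{n+1}Z$, whose faces are induced by the counit $FU\to\mathrm{Id}$ and whose degeneracies are induced by $F\eta U:FU\to FUFU$, where $\eta$ is the unit. Its geometric realization (the enriched colimit of $\mathsf B_\bullet(F,UF,UZ)$ weighted by $[n]\mapsto\Delta[n]$) is denoted $\mathsf B(F,UF,UZ)$. Theorem. Let $\mathcal N$ be a simplicial model category, $\mathcal M$ a simplicial category, and $F:\mathcal N\rightleftarrows\mathcal M:U$ a simplicial adjunction such that $U$ preserves pushouts and the monad $UF$ is Quillen unit-cofibrant. Let $g:A\to B$ be a $U$-cofibration in $\mathcal M$ such that the geometric realizations $\mathsf B(F,UF,UA)$ and $\mathsf B(F,UF,UB)$ exist in $\mathcal M$ (as they do, for instance, when $\mathcal M$ is cocomplete as a simplicial category). Then the induced map $$\mathsf B(F,UF,Ug):\mathsf B(F,UF,UA)\to\mathsf B(F,UF,UB)$$ is a projective cofibration. If $g$ is moreover $U$-acyclic, then it is a projective acyclic cofibration. -/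

import Mathlib

open CategoryTheory Limits HomotopicalAlgebra MonoidalCategory Opposite

universe v u u₁ u₂

noncomputable section

namespace SimplicialBar

/-! ### Simplicial functors and simplicial adjunctions -/

section Simplicial

variable {C : Type u₁} [Category.{v} C] [SimplicialCategory C]
  {D : Type u₂} [Category.{v} D] [SimplicialCategory D]

/-- The structure of a simplicially enriched functor on an ordinary functor `F` between
(the underlying categories of) simplicial categories: maps of simplicial hom-sets, compatible
with identities and composition, which on vertices are the action of `F` on morphisms. -/
structure SimplicialFunctor (F : C ⥤ D) where
  /-- the action on simplicial hom-sets -/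
  mapHom (X Y : C) : (X ⟶[SSet.{v}] Y) ⟶ (F.obj X ⟶[SSet.{v}] F.obj Y)
  mapHom_id (X : C) : eId SSet X ≫ mapHom X X = eId SSet (F.obj X)
  mapHom_comp (X Y Z : C) :
    eComp SSet X Y Z ≫ mapHom X Z =
      (mapHom X Y ⊗ₘ mapHom Y Z) ≫ eComp SSet (F.obj X) (F.obj Y) (F.obj Z)
  eHomEquiv_mapHom {X Y : C} (f : X ⟶ Y) :
    eHomEquiv SSet f ≫ mapHom X Y = eHomEquiv SSet (F.map f)

/-- An adjunction `F ⊣ U` between simplicial functors is a simplicial adjunction if its unit and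
its counit are simplicially natural. -/
structure IsSimplicialAdjunction {F : C ⥤ D} {U : D ⥤ C} (adj : F ⊣ U)
    (sF : SimplicialFunctor F) (sU : SimplicialFunctor U) : Prop where
  unit_naturality (X Y : C) :
    eHomWhiskerLeft SSet X (adj.unit.app Y) =
      sF.mapHom X Y ≫ sU.mapHom (F.obj X) (F.obj Y) ≫
        eHomWhiskerRight SSet (adj.unit.app X) (U.obj (F.obj Y))
  counit_naturality (X Y : D) :
    sU.mapHom X Y ≫ sF.mapHom (U.obj X) (U.obj Y) ≫
        eHomWhiskerLeft SSet (F.obj (U.obj X)) (adj.counit.app Y) =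
      eHomWhiskerRight SSet (adj.counit.app X) Y

/-- `π : K ⟶ Map(P, X)` exhibits `P` as the power (cotensor) of `X` by the simplicial set `K`:
maps of simplicial sets `L ⟶ Map(Y, P)` correspond to maps `L ⊗ K ⟶ Map(Y, X)`, i.e.
`Map(Y, P) ≅ Map(K, Map(Y, X))`. -/
def IsPower {K : SSet.{v}} {X P : C} (π : K ⟶ (P ⟶[SSet.{v}] X)) : Prop :=
  ∀ (Y : C) (L : SSet.{v}) (φ : L ⊗ K ⟶ (Y ⟶[SSet.{v}] X)),
    ∃! f : L ⟶ (Y ⟶[SSet.{v}] P), (f ⊗ₘ π) ≫ eComp SSet Y P X = φ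

/-- `η : K ⟶ Map(X, T)` exhibits `T` as the copower (tensor) of `X` by the simplicial set `K`:
maps of simplicial sets `L ⟶ Map(T, Y)` correspond to maps `K ⊗ L ⟶ Map(X, Y)`, i.e.
`Map(T, Y) ≅ Map(K, Map(X, Y))`. -/
def IsCopower {K : SSet.{v}} {X T : C} (η : K ⟶ (X ⟶[SSet.{v}] T)) : Prop :=
  ∀ (Y : C) (L : SSet.{v}) (φ : K ⊗ L ⟶ (X ⟶[SSet.{v}] Y)),
    ∃! f : L ⟶ (T ⟶[SSet.{v}] Y), (η ⊗ₘ f) ≫ eComp SSet X T Y = φ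

end Simplicial

/-- A simplicial model category: a model category which is also a simplicial category with powers
and copowers by simplicial sets, such that for a cofibration `i : A ⟶ B` and a fibration
`p : X ⟶ Y` the map `Map(B, X) ⟶ Map(A, X) ×_{Map(A, Y)} Map(B, Y)` is a Kan fibration
(right lifting property for the horn inclusions `J`), and is a trivial Kan fibration
(right lifting property for the boundary inclusions `I`) if `i` or `p` is a weak equivalence. -/
class SimplicialModelCategory (N : Type u) [Category.{v} N] [SimplicialCategory N]
    [ModelCategory N] : Prop where
  exists_power (K : SSet.{v}) (X : N) :
    ∃ (P : N) (π : K ⟶ (P ⟶[SSet.{v}] X)), IsPower π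
  exists_copower (K : SSet.{v}) (X : N) :
    ∃ (T : N) (η : K ⟶ (X ⟶[SSet.{v}] T)), IsCopower η
  fibration_pullbackHom {A B X Y : N} (i : A ⟶ B) (p : X ⟶ Y)
    [Cofibration i] [Fibration p] :
    SSet.modelCategoryQuillen.J.{v}.rlp
      (Functor.PullbackObjObj.ofHasPullback (eHomFunctor SSet.{v} N) i p).π
  trivialFibration_pullbackHom {A B X Y : N} (i : A ⟶ B) (p : X ⟶ Y)
    [Cofibration i] [Fibration p] (h : WeakEquivalence i ∨ WeakEquivalence p) :
    SSet.modelCategoryQuillen.I.{v}.rlp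
      (Functor.PullbackObjObj.ofHasPullback (eHomFunctor SSet.{v} N) i p).π

/-! ### Quillen cofibrations of functors -/

section Quillen

variable {C : Type u₁} [Category.{v} C] {D : Type u₂} [Category.{v} D]

/-- The Leibniz application of `α : S ⟶ T` to `i : A ⟶ B`: the canonical map from the pushout
of `S B ⟵ S A ⟶ T A` to `T B`. -/
def leibnizApp [HasPushouts D] {S T : C ⥤ D} (α : S ⟶ T) {A B : C} (i : A ⟶ B) :
    pushout (S.map i) (α.app A) ⟶ T.obj B :=
  pushout.desc (α.app B) (T.map i) (α.naturality i)

/-- A natural transformation between functors of model categories is a Quillen cofibration if its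
Leibniz application to any cofibration `i` is a cofibration, which is acyclic if `i` is. -/
def IsQuillenCofibration [ModelCategory C] [ModelCategory D] {S T : C ⥤ D} (α : S ⟶ T) : Prop :=
  ∀ ⦃A B : C⦄ (i : A ⟶ B), cofibrations C i →
    cofibrations D (leibnizApp α i) ∧
      (weakEquivalences C i → weakEquivalences D (leibnizApp α i))

/-- A monad on a model category is Quillen unit-cofibrant if its unit is a
Quillen cofibration. -/
def IsQuillenUnitCofibrant [ModelCategory C] (T : Monad C) : Prop :=
  IsQuillenCofibration T.η

end Quillen

/-! ### Classes of morphisms lifted along a functor -/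

section Lifted

variable {M : Type u₂} [Category.{v} M] {N : Type u₁} [Category.{v} N] [ModelCategory N]
  (U : M ⥤ N)

/-- The `U`-cofibrations. -/
def uCofibrations : MorphismProperty M := (cofibrations N).inverseImage U

/-- The `U`-fibrations. -/
def uFibrations : MorphismProperty M := (fibrations N).inverseImage U

/-- The `U`-weak equivalences (or `U`-acyclic morphisms). -/
def uWeakEquivalences : MorphismProperty M := (weakEquivalences N).inverseImage U

/-- Projective cofibrations: the left lifting property for all `U`-acyclic `U`-fibrations. -/
def projectiveCofibrations : MorphismProperty M := (uFibrations U ⊓ uWeakEquivalences U).llp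

/-- Projective acyclic cofibrations: the left lifting property for all `U`-fibrations. -/
def projectiveAcyclicCofibrations : MorphismProperty M := (uFibrations U).llp

end Lifted

/-! ### The simplicial bar construction -/

section Bar

variable {C : Type u} [Category.{v} C] (G : Comonad C)

/-- The iterated application `Gⁿ X` of a comonad, with `Gⁿ⁺¹ X = G (Gⁿ X)`. -/
def iter : ℕ → C → C
  | 0, X => X
  | n + 1, X => G.obj (iter n X)

/-- The functoriality of `Gⁿ`. -/
def iterMap : (n : ℕ) → {X Y : C} → (X ⟶ Y) → (iter G n X ⟶ iter G n Y)
  | 0, _, _, f => f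
  | n + 1, _, _, f => G.map (iterMap n f)

/-- Forget the value at `0` of a monotone map. -/
def tail {m n : ℕ} (f : Fin (m + 1) →o Fin n) : Fin m →o Fin n :=
  ⟨fun i => f i.succ, fun _ _ h => f.monotone (Fin.succ_le_succ_iff.2 h)⟩

/-- Shift down the values of a monotone map that does not take the value `0`. -/
def shift {m n : ℕ} (f : Fin (m + 1) →o Fin (n + 1)) (h : f 0 ≠ 0) : Fin (m + 1) →o Fin n :=
  ⟨fun i => (f i).pred (fun hi => h (le_antisymm (hi ▸ f.monotone (Fin.zero_le i))
      (Fin.zero_le _))),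
    fun _ _ hij => Fin.pred_le_pred_iff.2 (f.monotone hij)⟩

/-- For `f : G (Gⁿ X) ⟶ Gᵐ X`, the composite of the comultiplication and `G f`. -/
def comulStep {X : C} {m n : ℕ} (f : iter G (n + 1) X ⟶ iter G m X) :
    iter G (n + 1) X ⟶ iter G (m + 1) X :=
  G.δ.app (iter G n X) ≫ G.map f

/-- For `f : Gⁿ X ⟶ Gᵐ X`, the composite of the counit at the outermost `G` and `f`. -/
def counitStep {X : C} {m n : ℕ} (f : iter G n X ⟶ iter G m X) :
    iter G (n + 1) X ⟶ iter G m X :=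
  G.ε.app (iter G n X) ≫ f

/-- The contravariant action of monotone maps `f : {0, …, m-1} → {0, …, n-1}` on the powers of a
comonad: on the `j`-th of the `n` copies of `G`, counted from the outside, it is the iterated
comultiplication `G ⟶ Gᵏ`, with `k` the number of elements of the fibre of `f` over `j`
(the counit for `k = 0`, the identity for `k = 1`). -/
def act (X : C) : (m n : ℕ) → (Fin m →o Fin n) → (iter G n X ⟶ iter G m X)
  | 0, 0, _ => 𝟙 X
  | 0, n + 1, _ => counitStep G (act X 0 n ⟨Fin.elim0, fun i => i.elim0⟩)
  | _ + 1, 0, f => (f 0).elim0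
  | m + 1, n + 1, f =>
    if h : f 0 = 0 then comulStep G (act X m (n + 1) (tail f))
    else counitStep G (act X (m + 1) n (shift f h))
  termination_by m n => m + n

variable {G}

lemma counitStep_comp {X : C} {m n p : ℕ} (f : iter G n X ⟶ iter G m X)
    (g : iter G m X ⟶ iter G p X) : counitStep G f ≫ g = counitStep G (f ≫ g) :=
  Category.assoc (G.ε.app (iter G n X)) f g

lemma comulStep_comp_counitStep {X : C} {m n p : ℕ} (f : iter G (n + 1) X ⟶ iter G m X)
    (g : iter G m X ⟶ iter G p X) : comulStep G f ≫ counitStep G g = f ≫ g := by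
  have key : ∀ {A B D : C} (f : G.obj A ⟶ B) (g : B ⟶ D),
      (G.δ.app A ≫ G.map f) ≫ G.ε.app B ≫ g = f ≫ g := fun {A B D} f g => by
    rw [Category.assoc, Comonad.counit_naturality_assoc, G.left_counit_assoc]
  exact key f g

lemma comulStep_comp_comulStep {X : C} {m n p : ℕ} (f : iter G (n + 1) X ⟶ iter G m X)
    (g : iter G (m + 1) X ⟶ iter G p X) :
    comulStep G f ≫ comulStep G g = comulStep G (comulStep G f ≫ g) := by
  have key : ∀ {A B D : C} (f : G.obj A ⟶ B) (g : G.obj B ⟶ D),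
      (G.δ.app A ≫ G.map f) ≫ G.δ.app B ≫ G.map g =
        G.δ.app A ≫ G.map ((G.δ.app A ≫ G.map f) ≫ g) := fun {A B D} f g => by
    simp only [Functor.map_comp, Category.assoc]
    rw [Comonad.delta_naturality_assoc, ← G.coassoc_assoc]
  exact key _ _

lemma comulStep_counitStep_id (X : C) (n : ℕ) :
    comulStep G (counitStep G (𝟙 (iter G n X))) = 𝟙 _ := by
  have key : ∀ A : C, G.δ.app A ≫ G.map (G.ε.app A ≫ 𝟙 A) = 𝟙 (G.obj A) := fun A => by
    exact (congrArg (fun x => G.δ.app A ≫ G.map x) (Category.comp_id _)).trans (G.right_counit A)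
  exact key _

lemma act_zero {X : C} {n : ℕ} (f : Fin 0 →o Fin (n + 1)) (f' : Fin 0 →o Fin n) :
    act G X 0 (n + 1) f = counitStep G (act G X 0 n f') := by
  rw [act]
  congr 2
  ext i
  exact i.elim0

lemma act_of_eq {X : C} {m n : ℕ} (f : Fin (m + 1) →o Fin (n + 1)) (h : f 0 = 0) :
    act G X (m + 1) (n + 1) f = comulStep G (act G X m (n + 1) (tail f)) := by
  rw [act, dif_pos h]

lemma act_of_ne {X : C} {m n : ℕ} (f : Fin (m + 1) →o Fin (n + 1)) (h : f 0 ≠ 0) :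
    act G X (m + 1) (n + 1) f = counitStep G (act G X (m + 1) n (shift f h)) := by
  rw [act, dif_neg h]

lemma act_id (X : C) : ∀ n : ℕ, act G X n n OrderHom.id = 𝟙 _
  | 0 => by rw [act]; rfl
  | n + 1 => by
    rw [act_of_eq _ rfl]
    have key : act G X n (n + 1) (tail OrderHom.id) = counitStep G (𝟙 _) := by
      cases n with
      | zero => rw [act_zero _ OrderHom.id, act_id X 0]
      | succ n =>
        rw [act_of_ne _ (by simp [tail])]
        have : shift (tail (OrderHom.id : Fin (n + 1 + 1) →o _)) (by simp [tail]) =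
            OrderHom.id := by
          ext i; simp [shift, tail]
        rw [this, act_id X (n + 1)]
    rw [key, comulStep_counitStep_id]

lemma act_comp (X : C) : ∀ (m n p : ℕ) (f : Fin m →o Fin n) (g : Fin n →o Fin p),
    act G X m p (g.comp f) = act G X n p g ≫ act G X m n f
  | m, 0, 0, f, g => by
    have : g = OrderHom.id := by ext i; exact i.elim0
    subst this
    rw [act_id, Category.id_comp]
    rfl
  | m, n + 1, 0, f, g => (g 0).elim0
  | 0, 0, p + 1, f, g => by
    have h : f = OrderHom.id := by ext i; exact i.elim0
    have h' : g.comp f = g := by ext i; exact i.elim0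
    rw [h', h, act_id, Category.comp_id]
  | m + 1, 0, p + 1, f, g => (f 0).elim0
  | 0, n + 1, p + 1, f, g => by
    by_cases hg : g 0 = 0
    · let e : Fin 0 →o Fin n := ⟨Fin.elim0, fun i => i.elim0⟩
      have h' : g.comp f = (tail g).comp e := by ext i; exact i.elim0
      rw [act_of_eq g hg, act_zero f e, comulStep_comp_counitStep, h',
        act_comp X 0 n (p + 1) e (tail g)]
    · rw [act_of_ne g hg, act_zero _ ((shift g hg).comp f), act_comp X 0 (n + 1) p f,
        counitStep_comp]
  | m + 1, n + 1, p + 1, f, g => by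
    by_cases hg : g 0 = 0
    · by_cases hf : f 0 = 0
      · have h' : tail (g.comp f) = g.comp (tail f) := rfl
        rw [act_of_eq f hf, act_of_eq (g.comp f) (by simp [hf, hg]), h',
          act_comp X m (n + 1) (p + 1) (tail f) g, act_of_eq g hg, comulStep_comp_comulStep]
      · have h' : g.comp f = (tail g).comp (shift f hf) := by
          ext i
          have hi : f i ≠ 0 := fun hi =>
            hf (le_antisymm (hi ▸ f.monotone (Fin.zero_le i)) (Fin.zero_le _))
          exact congrArg (fun j => (g j).val) (Fin.succ_pred (f i) hi).symm
        rw [act_of_eq g hg, act_of_ne f hf, h',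
          act_comp X (m + 1) n (p + 1) (shift f hf) (tail g), comulStep_comp_counitStep]
    · have hgf : (g.comp f) 0 ≠ 0 := fun h => hg
        (le_antisymm (h ▸ g.monotone (Fin.zero_le (f 0))) (Fin.zero_le _))
      have h' : shift (g.comp f) hgf = (shift g hg).comp f := rfl
      rw [act_of_ne g hg, act_of_ne _ hgf, h', act_comp X (m + 1) (n + 1) p f, counitStep_comp]
  termination_by m n p => m + n + p

lemma counitStep_naturality {X Y : C} (t : X ⟶ Y) {m n : ℕ} {f : iter G n X ⟶ iter G m X}
    {f' : iter G n Y ⟶ iter G m Y} (h : f ≫ iterMap G m t = iterMap G n t ≫ f') :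
    counitStep G f ≫ iterMap G m t = iterMap G (n + 1) t ≫ counitStep G f' := by
  have key : ∀ {A A' B B' : C} (a : A ⟶ A') (b : B ⟶ B') (f : A ⟶ B) (f' : A' ⟶ B'),
      f ≫ b = a ≫ f' → (G.ε.app A ≫ f) ≫ b = G.map a ≫ G.ε.app A' ≫ f' :=
    fun a b f f' h => by rw [Category.assoc, h, Comonad.counit_naturality_assoc]
  exact key _ _ _ _ h

lemma comulStep_naturality {X Y : C} (t : X ⟶ Y) {m n : ℕ}
    {f : iter G (n + 1) X ⟶ iter G m X} {f' : iter G (n + 1) Y ⟶ iter G m Y}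
    (h : f ≫ iterMap G m t = iterMap G (n + 1) t ≫ f') :
    comulStep G f ≫ iterMap G (m + 1) t = iterMap G (n + 1) t ≫ comulStep G f' := by
  have key : ∀ {A A' B B' : C} (a : A ⟶ A') (b : B ⟶ B') (f : G.obj A ⟶ B)
      (f' : G.obj A' ⟶ B'), f ≫ b = G.map a ≫ f' →
      (G.δ.app A ≫ G.map f) ≫ G.map b = G.map a ≫ G.δ.app A' ≫ G.map f' :=
    fun a b f f' h => by
      rw [Category.assoc, ← G.map_comp, h, Comonad.delta_naturality_assoc, G.map_comp]
  exact key _ _ _ _ h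

lemma act_naturality {X Y : C} (t : X ⟶ Y) : ∀ (m n : ℕ) (f : Fin m →o Fin n),
    act G X m n f ≫ iterMap G m t = iterMap G n t ≫ act G Y m n f
  | 0, 0, f => by
    have h : f = OrderHom.id := by ext i; exact i.elim0
    rw [h, act_id, act_id, Category.id_comp, Category.comp_id]
  | 0, n + 1, f => by
    let e : Fin 0 →o Fin n := ⟨Fin.elim0, fun i => i.elim0⟩
    rw [act_zero f e, act_zero f e]
    exact counitStep_naturality t (act_naturality t 0 n e)
  | m + 1, 0, f => (f 0).elim0
  | m + 1, n + 1, f => by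
    by_cases h : f 0 = 0
    · rw [act_of_eq f h, act_of_eq f h]
      exact comulStep_naturality t (act_naturality t m (n + 1) (tail f))
    · rw [act_of_ne f h, act_of_ne f h]
      exact counitStep_naturality t (act_naturality t (m + 1) n (shift f h))
  termination_by m n => m + n

lemma iterMap_id (X : C) : ∀ n : ℕ, iterMap G n (𝟙 X) = 𝟙 _
  | 0 => rfl
  | n + 1 => by
    change G.map (iterMap G n (𝟙 X)) = _
    rw [iterMap_id X n]
    exact G.map_id _

lemma iterMap_comp {X Y Z : C} (f : X ⟶ Y) (g : Y ⟶ Z) :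
    ∀ n : ℕ, iterMap G n (f ≫ g) = iterMap G n f ≫ iterMap G n g
  | 0 => rfl
  | n + 1 => by
    change G.map (iterMap G n (f ≫ g)) = G.map _ ≫ G.map _
    rw [iterMap_comp f g n, G.map_comp]

variable (G)

/-- The comonad resolution: the simplicial object with `n`-simplices `Gⁿ⁺¹ X`, faces
`Gⁱ ε Gⁿ⁻ⁱ` and degeneracies `Gⁱ δ Gⁿ⁻ⁱ`. -/
def resolution : C ⥤ SimplicialObject C where
  obj X :=
    { obj := fun n => iter G (n.unop.len + 1) X
      map := fun φ => act G X _ _ φ.unop.toOrderHom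
      map_id := fun n => act_id X _
      map_comp := fun φ ψ => act_comp X _ _ _ ψ.unop.toOrderHom φ.unop.toOrderHom }
  map t :=
    { app := fun n => iterMap G (n.unop.len + 1) t
      naturality := fun _ _ φ => act_naturality t _ _ φ.unop.toOrderHom }
  map_id X := by ext n; exact iterMap_id X _
  map_comp f g := by ext n; exact iterMap_comp f g _

variable {N : Type u₁} [Category.{v} N] {M : Type u₂} [Category.{v} M]
  {F : N ⥤ M} {U : M ⥤ N}

/-- The simplicial bar construction `Z ↦ B_•(F, UF, UZ)` of an adjunction `F ⊣ U`. Its object of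
`n`-simplices is `F (UF)ⁿ U Z = (FU)ⁿ⁺¹ Z`; the `i`-th face is the counit `FU ⟶ Id` and the
`i`-th degeneracy is `F η U : FU ⟶ FUFU`, with `η` the unit, applied at the `i`-th copy of `FU`
from the outside, for `i = 0, …, n`. -/
def barConstruction (adj : F ⊣ U) : M ⥤ SimplicialObject M := resolution adj.toComonad

end Bar

/-! ### Geometric realization -/

section Realization

variable {C : Type u} [Category.{v} C] [SimplicialCategory C]

/-- A geometric realization of a simplicial object `X` of a simplicial category: the (enriched)
colimit of `X` weighted by `n ↦ Δ[n]`, i.e. the coend of the copowers `Δ[n] ⊙ X_n`. It is an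
object `pt` with maps `Δ[n] ⟶ Map(X_n, pt)` natural in `n`, such that, for all simplicial
sets `K` and objects `Y`, maps `K ⟶ Map(pt, Y)` correspond to families of maps
`Δ[n] ⊗ K ⟶ Map(X_n, Y)` natural in `n`. -/
structure Realization (X : SimplicialObject C) where
  /-- the realization -/
  pt : C
  /-- the universal cocone -/
  ι (n : SimplexCategory) : SSet.stdSimplex.{v}.obj n ⟶ (X.obj (op n) ⟶[SSet.{v}] pt)
  ι_naturality {m n : SimplexCategory} (θ : m ⟶ n) :
    SSet.stdSimplex.{v}.map θ ≫ ι n = ι m ≫ eHomWhiskerRight SSet (X.map θ.op) pt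
  existsUnique_desc (Y : C) (K : SSet.{v})
    (φ : ∀ n : SimplexCategory, SSet.stdSimplex.{v}.obj n ⊗ K ⟶ (X.obj (op n) ⟶[SSet.{v}] Y))
    (_ : ∀ {m n : SimplexCategory} (θ : m ⟶ n),
      SSet.stdSimplex.{v}.map θ ▷ K ≫ φ n = φ m ≫ eHomWhiskerRight SSet (X.map θ.op) Y) :
    ∃! f : K ⟶ (pt ⟶[SSet.{v}] Y),
      ∀ n : SimplexCategory, (ι n ⊗ₘ f) ≫ eComp SSet (X.obj (op n)) pt Y = φ n

namespace Realization

variable {X X' : SimplicialObject C}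

lemma existsUnique_map (R : Realization X) (R' : Realization X') (g : X ⟶ X') :
    ∃! f : 𝟙_ SSet.{v} ⟶ (R.pt ⟶[SSet.{v}] R'.pt),
      ∀ n : SimplexCategory, (R.ι n ⊗ₘ f) ≫ eComp SSet (X.obj (op n)) R.pt R'.pt =
        (ρ_ _).hom ≫ R'.ι n ≫ eHomWhiskerRight SSet (g.app (op n)) R'.pt := by
  refine R.existsUnique_desc R'.pt (𝟙_ _) _ (fun {m n} θ => ?_)
  rw [rightUnitor_naturality_assoc, reassoc_of% (R'.ι_naturality θ), Category.assoc,
    Category.assoc, ← eHomWhiskerRight_comp, ← eHomWhiskerRight_comp, g.naturality]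

/-- The map between realizations induced by a map of simplicial objects. -/
def map (R : Realization X) (R' : Realization X') (g : X ⟶ X') : R.pt ⟶ R'.pt :=
  (eHomEquiv SSet.{v}).symm (R.existsUnique_map R' g).choose

/-- The induced map is compatible with the universal cocones. -/
lemma ι_map (R : Realization X) (R' : Realization X') (g : X ⟶ X') (n : SimplexCategory) :
    R.ι n ≫ eHomWhiskerLeft SSet (X.obj (op n)) (R.map R' g) =
      R'.ι n ≫ eHomWhiskerRight SSet (g.app (op n)) R'.pt := by
  have h := (R.existsUnique_map R' g).choose_spec.1 n
  have e : eHomEquiv SSet.{v} (R.map R' g) = (R.existsUnique_map R' g).choose :=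
    Equiv.apply_symm_apply _ _
  rw [← e, MonoidalCategory.tensorHom_def, Category.assoc] at h
  rw [← cancel_epi (ρ_ _).hom, ← h, eHomWhiskerLeft, ← rightUnitor_naturality_assoc,
    Iso.hom_inv_id_assoc]

end Realization

end Realization

end SimplicialBar

end

noncomputable section

namespace SimplicialBar

/-! Write `T = UF`. A morphism out of the realization of a simplicial object `Z` into `X` is a map
of cosimplicial simplicial sets from `Δ[•]` to `Map(Z_•, X)`. A lifting problem for the realized map
against `p : X ⟶ Y` thus asks for a map `Δ[•] ⟶ Map(B_•(F, T, UB), X)` with prescribed images in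
`Map(B_•(F, T, UA), X)` and `Map(B_•(F, T, UB), Y)`. As in Reedy theory, it can be built degree by
degree: in degree `n`, the boundary inclusion of `Δ[n]` has to be lifted against a relative matching
map (`exists_lift_of_hasMatchingLifts`).

The matching objects of `Map(B_•, X)` involve only the degeneracies of the bar construction. These
are `F` applied to the maps `Tⁱ η Tⁿ⁻ⁱ U`, whereas the outermost counit, which need not be in the
image of `F`, is a face. Hence the relative latching map of `B_•(F, T, Ug)` in degree `n` is `F` of
the `n`-fold Leibniz application of `η` to `Ug`. It has the required universal property because `T`
preserves pushouts (`latching_hom_ext`, `latching_exists_desc`), and powers in `N` extend that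
property to simplicial hom-sets.

Unit-cofibrancy makes these iterated Leibniz applications cofibrations, acyclic if `Ug` is
(`latching_mem`). The isomorphism `Map(F D, X) ≅ Map(D, U X)` moves the lifting problem to `N`,
where SM7 for the latching map and `U p` solves it. -/

lemma stdSimplex_map_comp {k l m : SimplexCategory} (f : k ⟶ l) (g : l ⟶ m) :
    SSet.stdSimplex.{v}.map (f ≫ g) = SSet.stdSimplex.map f ≫ SSet.stdSimplex.map g :=
  Functor.map_comp SSet.stdSimplex f g

lemma stdSimplex_map_comp_assoc {k l m : SimplexCategory} (f : k ⟶ l) (g : l ⟶ m) {Z : SSet.{v}}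
    (h : SSet.stdSimplex.obj m ⟶ Z) :
    SSet.stdSimplex.map (f ≫ g) ≫ h = SSet.stdSimplex.map f ≫ SSet.stdSimplex.map g ≫ h := by
  rw [stdSimplex_map_comp, Category.assoc]

lemma stdSimplex_map_id (k : SimplexCategory) : SSet.stdSimplex.{v}.map (𝟙 k) = 𝟙 _ :=
  CategoryTheory.Functor.map_id SSet.stdSimplex k

/-! ### Lifting maps out of the cosimplicial object of standard simplices -/

section CosimplicialLifting

open Simplicial

variable {T : Type u} {E : SimplexCategory ⥤ SSet.{v}} {P : T → SimplexCategory ⥤ SSet.{v}}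
  (q : ∀ t, E ⟶ P t) (ψ : ∀ t, SSet.stdSimplex.{v} ⟶ P t)

/-- A lift of `ψ` along `q` in cosimplicial degrees `< n`. -/
structure TruncatedLift (n : ℕ) where
  /-- the components of the lift -/
  app (k : SimplexCategory) (hk : k.len < n) : SSet.stdSimplex.{v}.obj k ⟶ E.obj k
  naturality {k l : SimplexCategory} (hk : k.len < n) (hl : l.len < n) (θ : k ⟶ l) :
    SSet.stdSimplex.map θ ≫ app l hl = app k hk ≫ E.map θ
  fac (k : SimplexCategory) (hk : k.len < n) (t : T) :
    app k hk ≫ (q t).app k = (ψ t).app k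

/-- The lifting property of the relative matching maps of `q` against the boundary inclusions,
at the simplices of `ψ`. -/
def HasMatchingLifts : Prop :=
  ∀ (n : ℕ) (a : (∂Δ[n] : SSet.{v}) ⟶ E.obj ⦋n⦌)
    -- The family `b` plays the role of a map from `Δ[n]` to the `n`-th matching object of `E`. It
    -- is indexed by all maps to lower degrees, not only the surjective ones, and no limit is
    -- formed.
    (b : ∀ k : SimplexCategory, k.len < n → (⦋n⦌ ⟶ k) → (Δ[n] ⟶ E.obj k)),
    (∀ (k l : SimplexCategory) (hk : k.len < n) (hl : l.len < n) (θ : ⦋n⦌ ⟶ k) (θ' : k ⟶ l),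
      b k hk θ ≫ E.map θ' = b l hl (θ ≫ θ')) →
    (∀ (k : SimplexCategory) (hk : k.len < n) (θ : ⦋n⦌ ⟶ k),
      a ≫ E.map θ = ∂Δ[n].ι ≫ b k hk θ) →
    (∀ t, a ≫ (q t).app ⦋n⦌ = ∂Δ[n].ι ≫ (ψ t).app ⦋n⦌) →
    (∀ (k : SimplexCategory) (hk : k.len < n) (θ : ⦋n⦌ ⟶ k) (t : T),
      b k hk θ ≫ (q t).app k = (ψ t).app ⦋n⦌ ≫ (P t).map θ) →
    ∃ d : Δ[n] ⟶ E.obj ⦋n⦌, ∂Δ[n].ι ≫ d = a ∧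
      (∀ (k : SimplexCategory) (hk : k.len < n) (θ : ⦋n⦌ ⟶ k), d ≫ E.map θ = b k hk θ) ∧
      ∀ t, d ≫ (q t).app ⦋n⦌ = (ψ t).app ⦋n⦌

namespace TruncatedLift

variable {q ψ} {n : ℕ} (φ : TruncatedLift q ψ n)

lemma naturality_comp {k l : SimplexCategory} (hk : k.len < n) (hl : l.len < n) (θ : k ⟶ l)
    {Z : SSet.{v}} (h : E.obj l ⟶ Z) :
    SSet.stdSimplex.map θ ≫ φ.app l hl ≫ h = φ.app k hk ≫ E.map θ ≫ h := by
  rw [← Category.assoc, φ.naturality hk hl, Category.assoc]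

/-- The strong epimorphism `e` lifts against the inclusion of the image of `θ`, so both
factorizations can be compared through this image, whose dimension is still `< n`. Consequently the
glued map on the boundary does not depend on the chosen factorization. -/
lemma app_comp_map_congr {k m i j : SimplexCategory} (hi : i.len < n) (hj : j.len < n)
    (e : k ⟶ i) [StrongEpi e] (μ : i ⟶ m) (x : k ⟶ j) (θ : j ⟶ m) (h : e ≫ μ = x ≫ θ) :
    SSet.stdSimplex.map e ≫ φ.app i hi ≫ E.map μ =
      SSet.stdSimplex.map x ≫ φ.app j hj ≫ E.map θ := by
  have hr : (image θ).len < n := lt_of_le_of_lt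
    (SimplexCategory.len_le_of_epi (factorThruImage θ)) hj
  have sq : CommSq (x ≫ factorThruImage θ) e (image.ι θ) μ := ⟨by simp [h]⟩
  conv_lhs => rw [← sq.fac_right, E.map_comp, ← φ.naturality_comp hi hr,
    ← stdSimplex_map_comp_assoc, sq.fac_left, stdSimplex_map_comp_assoc, φ.naturality_comp hj hr,
    ← E.map_comp, image.fac]

lemma epi_of_le_image_len {k m : SimplexCategory} (f : k ⟶ m) (h : m.len ≤ (image f).len) :
    Epi f := by
  have : IsIso (image.ι f) := (SimplexCategory.isIso_iff_of_mono (image.ι f)).2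
    (le_antisymm (SimplexCategory.len_le_of_mono (image.ι f)) h)
  rw [← image.fac f]
  exact epi_comp _ _

lemma image_len_lt {d : SimplexCategoryᵒᵖ}
    (s : (SSet.boundary.{v} n).toSSet.obj d) :
    (image (SSet.stdSimplex.objEquiv s.1)).len < n := by
  by_contra! h
  have := epi_of_le_image_len (m := ⦋n⦌) (SSet.stdSimplex.objEquiv s.1) h
  exact s.2 (SimplexCategory.epi_iff_surjective.1 this)

/-- The map `∂Δ[n] ⟶ E ⦋n⦌` glued from the components of a lift in degrees `< n`. -/
def boundaryMap : (∂Δ[n] : SSet.{v}) ⟶ E.obj ⦋n⦌ where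
  -- A simplex of the boundary is a non-surjective map to `⦋n⦌`. Its image has dimension `< n`,
  -- where the lift is already known.
  app d := TypeCat.ofHom fun s => SSet.yonedaEquiv
    (SSet.stdSimplex.map (factorThruImage (SSet.stdSimplex.objEquiv s.1)) ≫
      φ.app _ (image_len_lt s) ≫ E.map (image.ι (SSet.stdSimplex.objEquiv s.1)))
  naturality d d' f := by
    ext s
    refine Eq.trans ?_ (SSet.yonedaEquiv_naturality f.unop _).symm
    refine congrArg SSet.yonedaEquiv ?_
    rw [← stdSimplex_map_comp_assoc]
    refine φ.app_comp_map_congr _ _ _ _ _ _ ?_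
    rw [image.fac, Category.assoc, image.fac]
    rfl

lemma boundaryMap_app {d j : SimplexCategory} (s : (SSet.boundary.{v} n).toSSet.obj (op d))
    (hj : j.len < n) (x : d ⟶ j) (θ : j ⟶ ⦋n⦌)
    (h : SSet.stdSimplex.objEquiv s.1 = x ≫ θ) :
    φ.boundaryMap.app _ s =
      SSet.yonedaEquiv (SSet.stdSimplex.map x ≫ φ.app j hj ≫ E.map θ) :=
  congrArg SSet.yonedaEquiv (φ.app_comp_map_congr _ _ _ _ _ _ ((image.fac _).trans h))

/-- The extension of a lift in degrees `< n` by a compatible map in degree `n`. -/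
def extend (d : Δ[n] ⟶ E.obj ⦋n⦌) (h : ∂Δ[n].ι ≫ d = φ.boundaryMap)
    (h' : ∀ (k : SimplexCategory) (hk : k.len < n) (θ : ⦋n⦌ ⟶ k),
      d ≫ E.map θ = SSet.stdSimplex.map θ ≫ φ.app k hk)
    (h'' : ∀ t, d ≫ (q t).app ⦋n⦌ = (ψ t).app ⦋n⦌) : TruncatedLift q ψ (n + 1) where
  app k hk := if hk' : k.len < n then φ.app k hk' else
    have e : k = ⦋n⦌ := SimplexCategory.ext (le_antisymm (Nat.lt_succ_iff.1 hk) (not_lt.1 hk'))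
    SSet.stdSimplex.map (eqToHom e) ≫ d ≫ E.map (eqToHom e.symm)
  naturality {k l} hk hl θ := by
    -- Simplices of `Δ[n]` coming from a lower dimension lie in the boundary, where `d` is the glued
    -- map.
    have hd (j : SimplexCategory) (hj : j.len < n) (θ : j ⟶ ⦋n⦌) :
        SSet.stdSimplex.map θ ≫ d = φ.app j hj ≫ E.map θ := by
      ext ⟨c⟩ x
      let y := SSet.stdSimplex.objEquiv x
      have hs : (SSet.stdSimplex.map θ).app (op c) x ∈ (SSet.boundary.{v} n).obj (op c) :=
        fun hs => by
          have h1 : Epi (y ≫ θ) := SimplexCategory.epi_iff_surjective.2 hs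
          have h2 : Epi θ := epi_of_epi y θ
          exact absurd (SimplexCategory.len_le_of_epi θ) (not_le.2 hj)
      have h1 := φ.boundaryMap_app ⟨_, hs⟩ hj y θ rfl
      rw [← h] at h1
      refine h1.trans ?_
      rw [SSet.yonedaEquiv_comp, SSet.yonedaEquiv_map]
      rfl
    by_cases hk' : k.len < n
    · by_cases hl' : l.len < n
      · simp only [dif_pos hk', dif_pos hl', φ.naturality hk' hl']
      · obtain rfl : l = ⦋n⦌ := SimplexCategory.ext (by simp; omega)
        simp [hk', stdSimplex_map_id, hd _ hk']
    · obtain rfl : k = ⦋n⦌ := SimplexCategory.ext (by simp; omega)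
      by_cases hl' : l.len < n
      · simp [hl', stdSimplex_map_id, h' _ hl']
      · obtain rfl : l = ⦋n⦌ := SimplexCategory.ext (by simp; omega)
        suffices SSet.stdSimplex.map θ ≫ d = d ≫ E.map θ by simpa [stdSimplex_map_id]
        -- An endomorphism of `⦋n⦌` either factors through a lower dimension or is surjective, hence
        -- the identity.
        by_cases hθ : (image θ).len < n
        · conv_lhs => rw [← image.fac θ, stdSimplex_map_comp, Category.assoc, hd _ hθ]
          conv_rhs => rw [← image.fac θ, E.map_comp, reassoc_of% h' _ hθ]
        · have := epi_of_le_image_len θ (not_lt.1 hθ)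
          rw [SimplexCategory.eq_id_of_epi θ, stdSimplex_map_id, E.map_id, Category.id_comp,
            Category.comp_id]
  fac k hk t := by
    by_cases hk' : k.len < n
    · simp [hk', φ.fac]
    · obtain rfl : k = ⦋n⦌ := SimplexCategory.ext (by simp; omega)
      simp [stdSimplex_map_id, h'']

lemma extend_app (d : Δ[n] ⟶ E.obj ⦋n⦌) (h h' h'') (k : SimplexCategory) (hk : k.len < n) :
    (φ.extend d h h' h'').app k (Nat.lt_succ_of_lt hk) = φ.app k hk :=
  dif_pos hk

lemma exists_extension (H : HasMatchingLifts q ψ) : ∃ φ' : TruncatedLift q ψ (n + 1),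
    ∀ (k : SimplexCategory) (hk : k.len < n), φ'.app k (Nat.lt_succ_of_lt hk) = φ.app k hk := by
  obtain ⟨d, h, h', h''⟩ := H n φ.boundaryMap (fun k hk θ => SSet.stdSimplex.map θ ≫ φ.app k hk)
    (fun k l hk hl θ θ' => by
      rw [Category.assoc, ← φ.naturality hk hl, stdSimplex_map_comp_assoc])
    (fun k hk θ => by
      ext ⟨c⟩ s
      change (E.map θ).app _ (φ.boundaryMap.app _ s) = _
      rw [φ.boundaryMap_app s (image_len_lt s) _ _ (image.fac _).symm, ← SSet.yonedaEquiv_comp,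
        Category.assoc, Category.assoc, ← E.map_comp, ← φ.naturality _ hk,
        stdSimplex_map_comp_assoc, ← stdSimplex_map_comp_assoc, image.fac,
        ← stdSimplex_map_comp_assoc, SSet.yonedaEquiv_comp, SSet.yonedaEquiv_map]
      rfl)
    (fun t => by
      ext ⟨c⟩ s
      change ((q t).app _).app _ (φ.boundaryMap.app _ s) = _
      rw [φ.boundaryMap_app s (image_len_lt s) _ _ (image.fac _).symm, ← SSet.yonedaEquiv_comp,
        Category.assoc, Category.assoc, (q t).naturality, reassoc_of% φ.fac,
        ← (ψ t).naturality, ← stdSimplex_map_comp_assoc, image.fac, SSet.yonedaEquiv_comp,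
        SSet.yonedaEquiv_map]
      rfl)
    (fun k hk θ t => by
      rw [Category.assoc, φ.fac]
      exact (ψ t).naturality θ)
  exact ⟨φ.extend d h h' h'', φ.extend_app d h h' h''⟩

end TruncatedLift

/-- A family of cosimplices `ψ` lifts if the relative matching maps have the lifting property
against the boundary inclusions. -/
theorem exists_lift_of_hasMatchingLifts (H : HasMatchingLifts q ψ) :
    ∃ φ : SSet.stdSimplex.{v} ⟶ E, ∀ t, φ ≫ q t = ψ t := by
  choose next h_next using fun (n : ℕ) (φ : TruncatedLift q ψ n) => φ.exists_extension H
  let φ₀ : TruncatedLift q ψ 0 :=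
    { app := fun _ hk => (Nat.not_lt_zero _ hk).elim
      naturality := fun hk => (Nat.not_lt_zero _ hk).elim
      fac := fun _ hk => (Nat.not_lt_zero _ hk).elim }
  let Φ (n : ℕ) : TruncatedLift q ψ n := Nat.rec φ₀ next n
  -- The component in degree `k` is fixed from stage `k.len + 1` on, so the stages have a
  -- well-defined union.
  have hΦ (k : SimplexCategory) (m : ℕ) (hk : k.len < m) :
      (Φ m).app k hk = (Φ (k.len + 1)).app k (Nat.lt_succ_self _) := by
    induction m, Nat.succ_le_of_lt hk using Nat.le_induction with
    | base => rfl
    | succ m hm ih => exact (h_next m (Φ m) k hm).trans (ih hm)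
  refine ⟨{ app := fun k => (Φ (k.len + 1)).app k (Nat.lt_succ_self _)
            naturality := fun k l θ => ?_ }, fun t => ?_⟩
  · have hk : k.len < max k.len l.len + 1 := by omega
    have hl : l.len < max k.len l.len + 1 := by omega
    rw [← hΦ k _ hk, ← hΦ l _ hl]
    exact (Φ _).naturality hk hl θ
  · exact NatTrans.ext (funext fun k => (Φ (k.len + 1)).fac k (Nat.lt_succ_self _) t)

end CosimplicialLifting

/-! ### Relative latching objects as iterated Leibniz applications of the unit -/

section Latching

variable {N : Type u₁} [Category.{v} N] {M : Type u₂} [Category.{v} M]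
  {F : N ⥤ M} {U : M ⥤ N} (adj : F ⊣ U)

/-- The object `(UF)ⁿ U X = U (FU)ⁿ X`. -/
abbrev uIter (n : ℕ) (X : M) : N := U.obj (iter adj.toComonad n X)

/-- The map `Tⁱ η Tⁿ⁻ⁱ U : Tⁿ U X ⟶ Tⁿ⁺¹ U X` (for `i ≤ n`), with `η : Id ⟶ T = UF` the unit. -/
def unitInsertion (X : M) : (n _i : ℕ) → (uIter adj n X ⟶ uIter adj (n + 1) X)
  | n, 0 => adj.unit.app (uIter adj n X)
  -- A default value: only indices `i ≤ n` are meaningful.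
  | 0, _ + 1 => adj.unit.app (U.obj X)
  | n + 1, i + 1 => (F ⋙ U).map (unitInsertion X n i)

lemma unitInsertion_zero (X : M) (n : ℕ) :
    unitInsertion adj X n 0 = adj.unit.app (uIter adj n X) := by
  rw [unitInsertion]

variable [HasPushouts N] {A B : M} (h : A ⟶ B)

/-- The iterated Leibniz application of `η : Id ⟶ T` to `U h : U A ⟶ U B`, a map to `Tⁿ U B`. -/
def latching : (n : ℕ) → Over (uIter adj n B)
  | 0 => Over.mk (Y := U.obj A) (X := U.obj B) (U.map h)
  | n + 1 => Over.mk (X := (F ⋙ U).obj (uIter adj n B)) (leibnizApp adj.unit (latching n).hom)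

lemma latching_mem {W : MorphismProperty N} (hη : ∀ ⦃A B : N⦄ (i : A ⟶ B), W i →
    W (leibnizApp adj.unit i)) (hh : W (U.map h)) : ∀ n, W (latching adj h n).hom
  | 0 => hh
  | n + 1 => hη _ (latching_mem hη hh n)

/-- The inclusion of `T` applied to the source of the `n`-th relative latching map. -/
def latchingInr (n : ℕ) :
    (F ⋙ U).obj (latching adj h n).left ⟶ (latching adj h (n + 1)).left :=
  pushout.inr ((𝟭 N).map (latching adj h n).hom) (adj.unit.app (latching adj h n).left)

/-- The inclusion of `Tⁿ U B`, at the outermost position. -/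
def latchingInl (n : ℕ) : uIter adj n B ⟶ (latching adj h (n + 1)).left :=
  pushout.inl ((𝟭 N).map (latching adj h n).hom) (adj.unit.app (latching adj h n).left)

lemma isPushout_latching (n : ℕ) :
    IsPushout (latching adj h n).hom (adj.unit.app (latching adj h n).left)
      (latchingInl adj h n) (latchingInr adj h n) :=
  IsPushout.of_hasPushout ((𝟭 N).map (latching adj h n).hom) (adj.unit.app (latching adj h n).left)

lemma latchingInl_hom (n : ℕ) :
    latchingInl adj h n ≫ (latching adj h (n + 1)).hom = adj.unit.app (uIter adj n B) :=
  pushout.inl_desc _ _ _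

lemma latchingInr_hom (n : ℕ) :
    latchingInr adj h n ≫ (latching adj h (n + 1)).hom = (F ⋙ U).map (latching adj h n).hom :=
  pushout.inr_desc _ _ _

lemma map_latchingInr_hom (n : ℕ) {X : N} (x : X ⟶ (latching adj h n).left) :
    ((F ⋙ U).map x ≫ latchingInr adj h n) ≫ (latching adj h (n + 1)).hom =
      (F ⋙ U).map (x ≫ (latching adj h n).hom) := by
  rw [Category.assoc, latchingInr_hom]
  exact ((F ⋙ U).map_comp x _).symm

lemma map_map_latchingInr (n : ℕ) (S : N ⥤ N) {X R : N} (x : X ⟶ (latching adj h n).left)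
    (f : S.obj (latching adj h (n + 1)).left ⟶ R) :
    S.map ((F ⋙ U).map x ≫ latchingInr adj h n) ≫ f =
      S.map ((F ⋙ U).map x) ≫ S.map (latchingInr adj h n) ≫ f := by
  rw [S.map_comp, Category.assoc]

/-- The map from `Tⁿ U A` to the relative latching object. -/
def fromSource : (n : ℕ) → (uIter adj n A ⟶ (latching adj h n).left)
  | 0 => 𝟙 (U.obj A)
  | n + 1 => (F ⋙ U).map (fromSource n) ≫ latchingInr adj h n

/-- The map from `Tⁿ U B` to the relative latching object corresponding to `Tⁱ η Tⁿ⁻ⁱ`. -/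
def fromDegenerate : (n _i : ℕ) → (uIter adj n B ⟶ (latching adj h (n + 1)).left)
  | n, 0 => latchingInl adj h n
  | 0, _ + 1 => latchingInl adj h 0
  | n + 1, i + 1 => (F ⋙ U).map (fromDegenerate n i) ≫ latchingInr adj h (n + 1)

lemma fromSource_hom : ∀ n, fromSource adj h n ≫ (latching adj h n).hom =
    U.map (iterMap adj.toComonad n h)
  | 0 => Category.id_comp (U.map h)
  | n + 1 => (map_latchingInr_hom adj h n (fromSource adj h n)).trans
    (congrArg (F ⋙ U).map (fromSource_hom n))

lemma fromDegenerate_hom : ∀ n i, fromDegenerate adj h n i ≫ (latching adj h (n + 1)).hom =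
    unitInsertion adj B n i
  | n, 0 => by rw [fromDegenerate, latchingInl_hom, unitInsertion]
  | 0, i + 1 => by rw [fromDegenerate, latchingInl_hom, unitInsertion]; rfl
  | n + 1, i + 1 => (map_latchingInr_hom adj h (n + 1) (fromDegenerate adj h n i)).trans
    (congrArg (F ⋙ U).map (fromDegenerate_hom n i))

/-- The defining pushout splits off the outermost degeneracy (`i = 0`). The other leg is `T` applied
to the previous latching object, which is handled by induction with `S` replaced by `S ∘ T`; for
this reason `S` is arbitrary. -/
lemma latching_hom_ext (n : ℕ) (S : N ⥤ N) [PreservesColimitsOfShape WalkingSpan S] {R : N}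
    {f g : S.obj (latching adj h (n + 1)).left ⟶ R}
    (hA : S.map (fromSource adj h (n + 1)) ≫ f = S.map (fromSource adj h (n + 1)) ≫ g)
    (hB : ∀ i ≤ n, S.map (fromDegenerate adj h n i) ≫ f = S.map (fromDegenerate adj h n i) ≫ g)
    [PreservesColimitsOfShape WalkingSpan (F ⋙ U)] : f = g := by
  induction n generalizing S with
  | zero =>
    refine ((isPushout_latching adj h 0).map S).hom_ext (hB 0 le_rfl) ?_
    have e : fromSource adj h 1 = latchingInr adj h 0 := by
      rw [fromSource, fromSource]
      exact (congrArg (· ≫ _) ((F ⋙ U).map_id (U.obj A))).trans (Category.id_comp _)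
    rwa [e] at hA
  | succ n ih =>
    refine ((isPushout_latching adj h (n + 1)).map S).hom_ext (hB 0 (Nat.zero_le _)) ?_
    exact ih ((F ⋙ U) ⋙ S)
      ((map_map_latchingInr adj h (n + 1) S _ f).symm.trans
        (hA.trans (map_map_latchingInr adj h (n + 1) S _ g)))
      (fun i hi => (map_map_latchingInr adj h (n + 1) S _ f).symm.trans
        ((hB (i + 1) (Nat.succ_le_succ hi)).trans (map_map_latchingInr adj h (n + 1) S _ g)))

lemma latching_exists_desc_one (S : N ⥤ N) [PreservesColimitsOfShape WalkingSpan S] {R : N}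
    (a : S.obj (uIter adj 1 A) ⟶ R) (b : S.obj (uIter adj 0 B) ⟶ R)
    (hab : S.map (unitInsertion adj A 0 0) ≫ a = S.map (U.map (iterMap adj.toComonad 0 h)) ≫ b) :
    ∃ f : S.obj (latching adj h 1).left ⟶ R,
      S.map (fromSource adj h 1) ≫ f = a ∧ S.map (fromDegenerate adj h 0 0) ≫ f = b := by
  have e : fromSource adj h 1 = latchingInr adj h 0 := by
    rw [fromSource, fromSource]
    exact (congrArg (· ≫ _) ((F ⋙ U).map_id (U.obj A))).trans (Category.id_comp _)
  have sq := (isPushout_latching adj h 0).map S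
  rw [e]
  exact ⟨sq.desc b a hab.symm, sq.inr_desc _ _ _, sq.inl_desc _ _ _⟩

/-- Together with `latching_hom_ext`, this presents the latching object by the generators `Tⁿ⁺² U A`
and `n + 2` copies of `Tⁿ⁺¹ U B`. The relations are naturality in `h` and the identities between
successive unit insertions. Degree one is separate because it has a single degeneracy and no
identity of the second kind. -/
lemma latching_exists_desc (n : ℕ) (S : N ⥤ N) [PreservesColimitsOfShape WalkingSpan S]
    [PreservesColimitsOfShape WalkingSpan (F ⋙ U)] {R : N}
    (a : S.obj (uIter adj (n + 2) A) ⟶ R) (b : ℕ → (S.obj (uIter adj (n + 1) B) ⟶ R))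
    (hab : ∀ i ≤ n + 1, S.map (unitInsertion adj A (n + 1) i) ≫ a =
      S.map (U.map (iterMap adj.toComonad (n + 1) h)) ≫ b i)
    (hbb : ∀ i j, i ≤ j → j ≤ n → S.map (unitInsertion adj B n j) ≫ b i =
      S.map (unitInsertion adj B n i) ≫ b (j + 1)) :
    ∃ f : S.obj (latching adj h (n + 2)).left ⟶ R,
      S.map (fromSource adj h (n + 2)) ≫ f = a ∧
      ∀ i ≤ n + 1, S.map (fromDegenerate adj h (n + 1) i) ≫ f = b i := by
  -- Insertions at the inner positions `i + 1` are `T` of insertions at `i`, so they form the same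
  -- problem one degree lower for `S ∘ T`.
  obtain ⟨f, hfa, hfb⟩ : ∃ f : S.obj ((F ⋙ U).obj (latching adj h (n + 1)).left) ⟶ R,
      S.map ((F ⋙ U).map (fromSource adj h (n + 1))) ≫ f = a ∧
      ∀ i ≤ n, S.map ((F ⋙ U).map (fromDegenerate adj h n i)) ≫ f = b (i + 1) := by
    cases n with
    | zero =>
      obtain ⟨f, h₁, h₂⟩ := latching_exists_desc_one adj h ((F ⋙ U) ⋙ S) a (b 1) (hab 1 le_rfl)
      exact ⟨f, h₁, fun i hi => by obtain rfl : i = 0 := by omega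
                                   exact h₂⟩
    | succ n =>
      exact latching_exists_desc n ((F ⋙ U) ⋙ S) a (fun i => b (i + 1))
        (fun i hi => hab (i + 1) (by omega))
        (fun i j hij hj => hbb (i + 1) (j + 1) (by omega) (by omega))
  have sq := (isPushout_latching adj h (n + 1)).map S
  have key {X : N} (x : X ⟶ (latching adj h (n + 1)).left) :
      S.map x ≫ S.map (adj.unit.app (latching adj h (n + 1)).left) ≫ f =
        S.map (adj.unit.app X) ≫ S.map ((F ⋙ U).map x) ≫ f := by
    rw [← S.map_comp_assoc, ← S.map_comp_assoc, ← adj.unit.naturality, Functor.id_map]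
  -- The gluing condition with the outermost component is tested on generators: on the part from `A`
  -- it is `hab 0`, on the `i`-th copy from `B` it is `hbb 0 i`.
  have w : S.map (latching adj h (n + 1)).hom ≫ b 0 =
      S.map (adj.unit.app (latching adj h (n + 1)).left) ≫ f := by
    refine latching_hom_ext adj h n S ?_ (fun i hi => ?_)
    · refine Eq.trans ?_ (key (fromSource adj h (n + 1))).symm
      rw [← S.map_comp_assoc, fromSource_hom, hfa]
      exact (hab 0 (Nat.zero_le _)).symm
    · refine Eq.trans ?_ (key (fromDegenerate adj h n i)).symm
      rw [← S.map_comp_assoc, fromDegenerate_hom, hfb i hi]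
      rw [hbb 0 i (Nat.zero_le _) hi, unitInsertion_zero]
      rfl
  refine ⟨sq.desc (b 0) f w, ?_, ?_⟩
  · refine (map_map_latchingInr adj h (n + 1) S _ _).trans ?_
    rw [sq.inr_desc, hfa]
  · rintro (_ | i) hi
    · exact sq.inl_desc _ _ _
    · refine (map_map_latchingInr adj h (n + 1) S _ _).trans ?_
      rw [sq.inr_desc, hfb i (by omega)]

end Latching

/-! ### Powers and lifting properties of simplicial hom-sets -/

section EnrichedHom

open Simplicial

variable {N : Type u₁} [Category.{v} N] [SimplicialCategory N]

/-- This is the universal property of the power at `L` the unit. Families `K ⟶ Map(Y, X)` become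
ordinary morphisms `Y ⟶ P`, so ordinary pushouts in `N` can be used to glue them. -/
lemma IsPower.existsUnique_hom {K : SSet.{v}} {X P : N} {π : K ⟶ (P ⟶[SSet.{v}] X)}
    (hπ : IsPower π) (Y : N) (φ : K ⟶ (Y ⟶[SSet.{v}] X)) :
    ∃! y : Y ⟶ P, π ≫ eHomWhiskerRight SSet y X = φ := by
  have key (y : Y ⟶ P) : (eHomEquiv SSet.{v} y ⊗ₘ π) ≫ eComp SSet Y P X =
      (λ_ K).hom ≫ π ≫ eHomWhiskerRight SSet y X := by
    rw [eHomWhiskerRight, leftUnitor_inv_naturality_assoc, Iso.hom_inv_id_assoc,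
      MonoidalCategory.tensorHom_def', Category.assoc]
  obtain ⟨f, hf, hf'⟩ := hπ Y (𝟙_ _) ((λ_ K).hom ≫ φ)
  refine ⟨(eHomEquiv SSet.{v}).symm f, ?_, fun y hy => ?_⟩
  · change π ≫ eHomWhiskerRight SSet _ X = φ
    rw [← cancel_epi (λ_ K).hom, ← key, Equiv.apply_symm_apply, hf]
  · rw [Equiv.eq_symm_apply]
    exact hf' _ ((key y).trans (by rw [hy]))

/-- The lifting property against the boundary inclusions of the map
`Map(B, X) ⟶ Map(A, X) ×_{Map(A, Y)} Map(B, Y)` induced by `i : A ⟶ B` and `p : X ⟶ Y`. -/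
def HasBoundaryLifts {A B X Y : N} (i : A ⟶ B) (p : X ⟶ Y) : Prop :=
  ∀ (m : ℕ) (a : (∂Δ[m] : SSet.{v}) ⟶ (B ⟶[SSet.{v}] X)) (f : Δ[m] ⟶ (A ⟶[SSet.{v}] X))
    (e : Δ[m] ⟶ (B ⟶[SSet.{v}] Y)),
    a ≫ eHomWhiskerRight SSet i X = ∂Δ[m].ι ≫ f →
    a ≫ eHomWhiskerLeft SSet B p = ∂Δ[m].ι ≫ e →
    f ≫ eHomWhiskerLeft SSet A p = e ≫ eHomWhiskerRight SSet i Y →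
    ∃ d : Δ[m] ⟶ (B ⟶[SSet.{v}] X), ∂Δ[m].ι ≫ d = a ∧
      d ≫ eHomWhiskerRight SSet i X = f ∧ d ≫ eHomWhiskerLeft SSet B p = e

lemma exists_eHom_lift {A B X Y : N} {i : A ⟶ B} {p : X ⟶ Y}
    (sq : (eHomFunctor SSet.{v} N).PullbackObjObj i p) {K L : SSet.{v}} (j : K ⟶ L)
    [HasLiftingProperty j sq.π] (a : K ⟶ (B ⟶[SSet.{v}] X)) (f : L ⟶ (A ⟶[SSet.{v}] X))
    (e : L ⟶ (B ⟶[SSet.{v}] Y)) (haf : a ≫ eHomWhiskerRight SSet i X = j ≫ f)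
    (hae : a ≫ eHomWhiskerLeft SSet B p = j ≫ e)
    (hfe : f ≫ eHomWhiskerLeft SSet A p = e ≫ eHomWhiskerRight SSet i Y) :
    ∃ d : L ⟶ (B ⟶[SSet.{v}] X), j ≫ d = a ∧
      d ≫ eHomWhiskerRight SSet i X = f ∧ d ≫ eHomWhiskerLeft SSet B p = e := by
  let t : L ⟶ sq.pt := sq.isPullback.lift f e hfe
  have ht₁ : t ≫ sq.fst = f := sq.isPullback.lift_fst _ _ _
  have ht₂ : t ≫ sq.snd = e := sq.isPullback.lift_snd _ _ _
  have h₁ : sq.π ≫ sq.fst = eHomWhiskerRight SSet i X := sq.π_fst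
  have h₂ : sq.π ≫ sq.snd = eHomWhiskerLeft SSet B p := sq.π_snd
  have w : CommSq a j sq.π t := ⟨by
    refine sq.isPullback.hom_ext ?_ ?_
    · refine (Category.assoc _ _ _).trans (Eq.trans ?_ (Category.assoc _ _ _).symm)
      rw [ht₁]
      exact (congrArg (a ≫ ·) h₁).trans haf
    · refine (Category.assoc _ _ _).trans (Eq.trans ?_ (Category.assoc _ _ _).symm)
      rw [ht₂]
      exact (congrArg (a ≫ ·) h₂).trans hae⟩
  obtain ⟨⟨d, hd, hd'⟩⟩ := HasLiftingProperty.sq_hasLift (i := j) (p := sq.π) w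
  refine ⟨d, hd, ?_, ?_⟩
  · rw [← ht₁, ← h₁]
    exact (Category.assoc _ _ _).symm.trans (congrArg (· ≫ sq.fst) hd')
  · rw [← ht₂, ← h₂]
    exact (Category.assoc _ _ _).symm.trans (congrArg (· ≫ sq.snd) hd')

lemma hasBoundaryLifts [ModelCategory N] [SimplicialModelCategory N] {A B X Y : N}
    {i : A ⟶ B} {p : X ⟶ Y} (hi : cofibrations N i) (hp : fibrations N p)
    (h : weakEquivalences N i ∨ weakEquivalences N p) : HasBoundaryLifts i p := by
  intro m a f e haf hae hfe
  have := (cofibration_iff i).2 hi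
  have := (fibration_iff p).2 hp
  have := SimplicialModelCategory.trivialFibration_pullbackHom i p
    (h.imp (weakEquivalence_iff i).2 (weakEquivalence_iff p).2) _
    (SSet.modelCategoryQuillen.boundary_ι_mem_I m)
  exact exists_eHom_lift (Functor.PullbackObjObj.ofHasPullback (eHomFunctor SSet.{v} N) i p) _
    a f e haf hae hfe

end EnrichedHom

/-! ### Simplicial maps out of latching objects -/

section EnrichedLatching

variable {N : Type u₁} [Category.{v} N] [SimplicialCategory N] [HasPushouts N]
  {M : Type u₂} [Category.{v} M]
  {F : N ⥤ M} {U : M ⥤ N} (adj : F ⊣ U) {A B : M} (h : A ⟶ B)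
  {K : SSet.{v}} {X : N}

lemma eHom_latching_hom_ext {P : N} {π : K ⟶ (P ⟶[SSet.{v}] X)}
    (hπ : IsPower π) [PreservesColimitsOfShape WalkingSpan (F ⋙ U)] (n : ℕ)
    {f g : K ⟶ ((latching adj h (n + 1)).left ⟶[SSet.{v}] X)}
    (hA : f ≫ eHomWhiskerRight SSet (fromSource adj h (n + 1)) X =
      g ≫ eHomWhiskerRight SSet (fromSource adj h (n + 1)) X)
    (hB : ∀ i ≤ n, f ≫ eHomWhiskerRight SSet (fromDegenerate adj h n i) X =
      g ≫ eHomWhiskerRight SSet (fromDegenerate adj h n i) X) : f = g := by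
  obtain ⟨f, rfl, -⟩ := hπ.existsUnique_hom _ f
  obtain ⟨g, rfl, -⟩ := hπ.existsUnique_hom _ g
  simp only [Category.assoc, ← eHomWhiskerRight_comp] at hA hB
  rw [latching_hom_ext adj h n (𝟭 N) ((hπ.existsUnique_hom _ _).unique hA rfl)
    (fun i hi => (hπ.existsUnique_hom _ _).unique (hB i hi) rfl)]

lemma eHom_latching_exists_desc_one {P : N} {π : K ⟶ (P ⟶[SSet.{v}] X)}
    (hπ : IsPower π) (a : K ⟶ (uIter adj 1 A ⟶[SSet.{v}] X))
    (b : K ⟶ (uIter adj 0 B ⟶[SSet.{v}] X))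
    (hab : a ≫ eHomWhiskerRight SSet (unitInsertion adj A 0 0) X =
      b ≫ eHomWhiskerRight SSet (U.map (iterMap adj.toComonad 0 h)) X) :
    ∃ f : K ⟶ ((latching adj h 1).left ⟶[SSet.{v}] X),
      f ≫ eHomWhiskerRight SSet (fromSource adj h 1) X = a ∧
      f ≫ eHomWhiskerRight SSet (fromDegenerate adj h 0 0) X = b := by
  obtain ⟨a, rfl, -⟩ := hπ.existsUnique_hom _ a
  obtain ⟨b, rfl, -⟩ := hπ.existsUnique_hom _ b
  simp only [Category.assoc, ← eHomWhiskerRight_comp] at hab ⊢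
  obtain ⟨f, hfa, hfb⟩ := latching_exists_desc_one adj h (𝟭 N) a b
    ((hπ.existsUnique_hom _ _).unique hab rfl)
  refine ⟨π ≫ eHomWhiskerRight SSet f X, ?_, ?_⟩
  · rw [← hfa, Category.assoc, ← eHomWhiskerRight_comp, Functor.id_map]
  · rw [← hfb, Category.assoc, ← eHomWhiskerRight_comp, Functor.id_map]

lemma eHom_latching_exists_desc {P : N} {π : K ⟶ (P ⟶[SSet.{v}] X)}
    (hπ : IsPower π) [PreservesColimitsOfShape WalkingSpan (F ⋙ U)] (n : ℕ)
    (a : K ⟶ (uIter adj (n + 2) A ⟶[SSet.{v}] X))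
    (b : ℕ → (K ⟶ (uIter adj (n + 1) B ⟶[SSet.{v}] X)))
    (hab : ∀ i ≤ n + 1, a ≫ eHomWhiskerRight SSet (unitInsertion adj A (n + 1) i) X =
      b i ≫ eHomWhiskerRight SSet (U.map (iterMap adj.toComonad (n + 1) h)) X)
    (hbb : ∀ i j, i ≤ j → j ≤ n → b i ≫ eHomWhiskerRight SSet (unitInsertion adj B n j) X =
      b (j + 1) ≫ eHomWhiskerRight SSet (unitInsertion adj B n i) X) :
    ∃ f : K ⟶ ((latching adj h (n + 2)).left ⟶[SSet.{v}] X),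
      f ≫ eHomWhiskerRight SSet (fromSource adj h (n + 2)) X = a ∧
      ∀ i ≤ n + 1, f ≫ eHomWhiskerRight SSet (fromDegenerate adj h (n + 1) i) X = b i := by
  obtain ⟨a, rfl, -⟩ := hπ.existsUnique_hom _ a
  choose b' hb' using fun i => (hπ.existsUnique_hom _ (b i)).exists
  obtain rfl := funext hb'
  simp only [Category.assoc, ← eHomWhiskerRight_comp] at hab hbb ⊢
  obtain ⟨f, hfa, hfb⟩ := latching_exists_desc adj h n (𝟭 N) a b'
    (fun i hi => (hπ.existsUnique_hom _ _).unique (hab i hi) rfl)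
    (fun i j hij hj => (hπ.existsUnique_hom _ _).unique (hbb i j hij hj) rfl)
  refine ⟨π ≫ eHomWhiskerRight SSet f X, ?_, fun i hi => ?_⟩
  · rw [← hfa, Category.assoc, ← eHomWhiskerRight_comp, Functor.id_map]
  · rw [← hfb i hi, Category.assoc, ← eHomWhiskerRight_comp, Functor.id_map]

end EnrichedLatching

/-! ### The enriched hom isomorphism of a simplicial adjunction -/

section Transposition

variable {C : Type u₁} [Category.{v} C] [SimplicialCategory C]
  {D : Type u₂} [Category.{v} D] [SimplicialCategory D]

namespace SimplicialFunctor

variable {F : C ⥤ D} (sF : SimplicialFunctor F)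

lemma eHomWhiskerRight_mapHom {X X' : C} (f : X ⟶ X') (Y : C) :
    eHomWhiskerRight SSet f Y ≫ sF.mapHom X Y =
      sF.mapHom X' Y ≫ eHomWhiskerRight SSet (F.map f) (F.obj Y) := by
  rw [eHomWhiskerRight, eHomWhiskerRight, Category.assoc, Category.assoc, sF.mapHom_comp,
    leftUnitor_inv_naturality_assoc, ← sF.eHomEquiv_mapHom, MonoidalCategory.tensorHom_def',
    Category.assoc, comp_whiskerRight, Category.assoc, whisker_exchange_assoc,
    whisker_exchange_assoc, whisker_exchange_assoc]

lemma eHomWhiskerLeft_mapHom (X : C) {Y Y' : C} (g : Y ⟶ Y') :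
    eHomWhiskerLeft SSet X g ≫ sF.mapHom X Y' =
      sF.mapHom X Y ≫ eHomWhiskerLeft SSet (F.obj X) (F.map g) := by
  rw [eHomWhiskerLeft, eHomWhiskerLeft, Category.assoc, Category.assoc, sF.mapHom_comp,
    rightUnitor_inv_naturality_assoc, ← sF.eHomEquiv_mapHom, MonoidalCategory.tensorHom_def,
    Category.assoc, MonoidalCategory.whiskerLeft_comp, Category.assoc, ← whisker_exchange_assoc,
    ← whisker_exchange_assoc, ← whisker_exchange_assoc]

end SimplicialFunctor

variable {F : C ⥤ D} {U : D ⥤ C} {adj : F ⊣ U} {sF : SimplicialFunctor F}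
  {sU : SimplicialFunctor U} (hadj : IsSimplicialAdjunction adj sF sU)

namespace IsSimplicialAdjunction

/-- The isomorphism `Map(F X, Y) ≅ Map(X, U Y)` of a simplicial adjunction. -/
@[simps]
def homIso (X : C) (Y : D) : (F.obj X ⟶[SSet.{v}] Y) ≅ (X ⟶[SSet.{v}] U.obj Y) where
  hom := sU.mapHom (F.obj X) Y ≫
    eHomWhiskerRight SSet (X := X) (X' := U.obj (F.obj X)) (adj.unit.app X) (U.obj Y)
  inv := sF.mapHom X (U.obj Y) ≫
    eHomWhiskerLeft SSet (F.obj X) (Y := F.obj (U.obj Y)) (Y' := Y) (adj.counit.app Y)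
  hom_inv_id := by
    have h := hadj.counit_naturality (F.obj X) Y
    dsimp only [Functor.id_obj, Functor.comp_obj] at h
    rw [Category.assoc, reassoc_of% sF.eHomWhiskerRight_mapHom, ← eHom_whisker_exchange,
      reassoc_of% h, ← eHomWhiskerRight_comp, adj.left_triangle_components,
      eHomWhiskerRight_id]
  inv_hom_id := by
    have h := hadj.unit_naturality X (U.obj Y)
    dsimp only [Functor.id_obj, Functor.comp_obj] at h
    rw [Category.assoc, reassoc_of% sU.eHomWhiskerLeft_mapHom, eHom_whisker_exchange,
      ← reassoc_of% h, ← eHomWhiskerLeft_comp, adj.right_triangle_components,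
      eHomWhiskerLeft_id]

lemma eHomWhiskerRight_homIso_hom {X X' : C} (f : X ⟶ X') (Y : D) :
    eHomWhiskerRight SSet (F.map f) Y ≫ (hadj.homIso X Y).hom =
      (hadj.homIso X' Y).hom ≫ eHomWhiskerRight SSet f (U.obj Y) := by
  rw [homIso_hom, homIso_hom, reassoc_of% sU.eHomWhiskerRight_mapHom, Category.assoc,
    ← eHomWhiskerRight_comp, ← eHomWhiskerRight_comp]
  rw [adj.unit_naturality]

lemma eHomWhiskerLeft_homIso_hom (X : C) {Y Y' : D} (g : Y ⟶ Y') :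
    eHomWhiskerLeft SSet (F.obj X) g ≫ (hadj.homIso X Y').hom =
      (hadj.homIso X Y).hom ≫ eHomWhiskerLeft SSet X (U.map g) := by
  rw [homIso_hom, homIso_hom, reassoc_of% sU.eHomWhiskerLeft_mapHom, Category.assoc,
    eHom_whisker_exchange]

end IsSimplicialAdjunction

end Transposition

/-! ### Lifting in one degree, transposed along the adjunction -/

section TransposedLifting

open Simplicial

variable {N : Type u₁} [Category.{v} N] [SimplicialCategory N]
  {M : Type u₂} [Category.{v} M] [SimplicialCategory M]
  {F : N ⥤ M} {U : M ⥤ N} {adj : F ⊣ U} {sF : SimplicialFunctor F} {sU : SimplicialFunctor U}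
  {A B : M} {g : A ⟶ B} {X Y : M} {p : X ⟶ Y} {m : ℕ}

lemma HasBoundaryLifts.of_isSimplicialAdjunction (hadj : IsSimplicialAdjunction adj sF sU)
    {D D' : N} {i : D ⟶ D'} (h : HasBoundaryLifts i (U.map p)) : HasBoundaryLifts (F.map i) p := by
  intro m a f e haf hae hfe
  obtain ⟨d, hda, hdf, hde⟩ := h m (a ≫ (hadj.homIso _ _).hom) (f ≫ (hadj.homIso _ _).hom)
    (e ≫ (hadj.homIso _ _).hom)
    (by rw [Category.assoc, ← hadj.eHomWhiskerRight_homIso_hom, reassoc_of% haf])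
    (by rw [Category.assoc, ← hadj.eHomWhiskerLeft_homIso_hom, reassoc_of% hae])
    (by rw [Category.assoc, Category.assoc, ← hadj.eHomWhiskerLeft_homIso_hom, reassoc_of% hfe,
          hadj.eHomWhiskerRight_homIso_hom])
  refine ⟨d ≫ (hadj.homIso _ _).inv, by rw [reassoc_of% hda, Iso.hom_inv_id, Category.comp_id],
    ?_, ?_⟩
  · rw [← cancel_mono (hadj.homIso _ _).hom, ← hdf, Category.assoc, Category.assoc,
      hadj.eHomWhiskerRight_homIso_hom, Iso.inv_hom_id_assoc]
  · rw [← cancel_mono (hadj.homIso _ _).hom, ← hde, Category.assoc, Category.assoc,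
      hadj.eHomWhiskerLeft_homIso_hom, Iso.inv_hom_id_assoc]

/-- Transposition reduces this to maps out of the latching object in `N`. In `hbb`, the variable `k`
with `k + 1 = n` makes the condition vacuous for `n = 0`, so that all degrees share one statement.
-/
lemma exists_desc_latching_left (hadj : IsSimplicialAdjunction adj sF sU)
    [HasPushouts N] [PreservesColimitsOfShape WalkingSpan (F ⋙ U)]
    (hpow : ∀ (K : SSet.{v}) (X : N), ∃ (P : N) (π : K ⟶ (P ⟶[SSet.{v}] X)), IsPower π)
    {K : SSet.{v}} (n : ℕ) (c : K ⟶ (F.obj (uIter adj (n + 1) A) ⟶[SSet.{v}] X))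
    (b : ℕ → (K ⟶ (F.obj (uIter adj n B) ⟶[SSet.{v}] X)))
    (hcb : ∀ i ≤ n, c ≫ eHomWhiskerRight SSet (F.map (unitInsertion adj A n i)) X =
      b i ≫ eHomWhiskerRight SSet (F.map (U.map (iterMap adj.toComonad n g))) X)
    (hbb : ∀ (k : ℕ) (hk : k + 1 = n) (i j : ℕ), i ≤ j → j ≤ k →
      b i ≫ eHomWhiskerRight SSet (F.map (unitInsertion adj B k j ≫ eqToHom (by rw [hk]))) X =
        b (j + 1) ≫
          eHomWhiskerRight SSet (F.map (unitInsertion adj B k i ≫ eqToHom (by rw [hk]))) X) :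
    ∃ f : K ⟶ (F.obj (latching adj g (n + 1)).left ⟶[SSet.{v}] X),
      f ≫ eHomWhiskerRight SSet (F.map (fromSource adj g (n + 1))) X = c ∧
      ∀ i ≤ n, f ≫ eHomWhiskerRight SSet (F.map (fromDegenerate adj g n i)) X = b i := by
  obtain ⟨P, π, hπ⟩ := hpow K (U.obj X)
  have hr {D D' : N} (s : D ⟶ D') (x : K ⟶ (F.obj D' ⟶[SSet.{v}] X)) :
      (x ≫ (hadj.homIso _ _).hom) ≫ eHomWhiskerRight SSet s (U.obj X) =
        (x ≫ eHomWhiskerRight SSet (F.map s) X) ≫ (hadj.homIso _ _).hom := by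
    rw [Category.assoc, Category.assoc, hadj.eHomWhiskerRight_homIso_hom]
  obtain ⟨f, hfc, hfb⟩ : ∃ f : K ⟶ ((latching adj g (n + 1)).left ⟶[SSet.{v}] U.obj X),
      f ≫ eHomWhiskerRight SSet (fromSource adj g (n + 1)) (U.obj X) =
        c ≫ (hadj.homIso _ _).hom ∧
      ∀ i ≤ n, f ≫ eHomWhiskerRight SSet (fromDegenerate adj g n i) (U.obj X) =
        b i ≫ (hadj.homIso _ _).hom := by
    cases n with
    | zero =>
      obtain ⟨f, hfc, hfb⟩ := eHom_latching_exists_desc_one adj g hπ (c ≫ (hadj.homIso _ _).hom)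
        (b 0 ≫ (hadj.homIso _ _).hom) (by rw [hr, hr, hcb 0 le_rfl])
      exact ⟨f, hfc, fun i hi => by obtain rfl := Nat.le_zero.1 hi; exact hfb⟩
    | succ n =>
      exact eHom_latching_exists_desc adj g hπ n (c ≫ (hadj.homIso _ _).hom)
        (fun i => b i ≫ (hadj.homIso _ _).hom) (fun i hi => by rw [hr, hr, hcb i hi])
        (fun i j hij hj => by
          have := hbb n rfl i j hij hj
          simp only [eqToHom_refl, Category.comp_id] at this
          rw [hr, hr, this])
  have hl {D D' : N} (s : D ⟶ D') (x : K ⟶ (F.obj D ⟶[SSet.{v}] X))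
      (x' : K ⟶ (D' ⟶[SSet.{v}] U.obj X))
      (h : x' ≫ eHomWhiskerRight SSet s (U.obj X) = x ≫ (hadj.homIso _ _).hom) :
      (x' ≫ (hadj.homIso _ _).inv) ≫ eHomWhiskerRight SSet (F.map s) X = x := by
    rw [← cancel_mono (hadj.homIso _ _).hom, ← hr, Category.assoc x', Iso.inv_hom_id,
      Category.comp_id, h]
  exact ⟨f ≫ (hadj.homIso _ _).inv, hl _ _ _ hfc, fun i hi => hl _ _ _ (hfb i hi)⟩

lemma latching_left_hom_ext (hadj : IsSimplicialAdjunction adj sF sU)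
    [HasPushouts N] [PreservesColimitsOfShape WalkingSpan (F ⋙ U)]
    (hpow : ∀ (K : SSet.{v}) (X : N), ∃ (P : N) (π : K ⟶ (P ⟶[SSet.{v}] X)), IsPower π)
    {K : SSet.{v}} (n : ℕ) {f f' : K ⟶ (F.obj (latching adj g (n + 1)).left ⟶[SSet.{v}] X)}
    (hA : f ≫ eHomWhiskerRight SSet (F.map (fromSource adj g (n + 1))) X =
      f' ≫ eHomWhiskerRight SSet (F.map (fromSource adj g (n + 1))) X)
    (hB : ∀ i ≤ n, f ≫ eHomWhiskerRight SSet (F.map (fromDegenerate adj g n i)) X =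
      f' ≫ eHomWhiskerRight SSet (F.map (fromDegenerate adj g n i)) X) : f = f' := by
  obtain ⟨P, π, hπ⟩ := hpow K (U.obj X)
  rw [← cancel_mono (hadj.homIso _ _).hom]
  refine eHom_latching_hom_ext adj g hπ n ?_ (fun i hi => ?_)
  · rw [Category.assoc, Category.assoc, ← hadj.eHomWhiskerRight_homIso_hom, reassoc_of% hA]
  · rw [Category.assoc, Category.assoc, ← hadj.eHomWhiskerRight_homIso_hom,
      reassoc_of% hB i hi]

/-- The data `b` on degeneracies and `c` on the part from `A` glue to one map `f` on `F` of the
latching object. What remains is a single boundary lifting problem for `F` of the latching map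
against `p`, whose compatibilities are checked on generators. -/
lemma exists_lift_succ (hadj : IsSimplicialAdjunction adj sF sU)
    [HasPushouts N] [PreservesColimitsOfShape WalkingSpan (F ⋙ U)]
    (hpow : ∀ (K : SSet.{v}) (X : N), ∃ (P : N) (π : K ⟶ (P ⟶[SSet.{v}] X)), IsPower π)
    {n : ℕ} (hp : HasBoundaryLifts (latching adj g (n + 1)).hom (U.map p))
    (a : (∂Δ[m] : SSet.{v}) ⟶ (F.obj (uIter adj (n + 1) B) ⟶[SSet.{v}] X))
    (b : ℕ → (Δ[m] ⟶ (F.obj (uIter adj n B) ⟶[SSet.{v}] X)))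
    (c : Δ[m] ⟶ (F.obj (uIter adj (n + 1) A) ⟶[SSet.{v}] X))
    (e : Δ[m] ⟶ (F.obj (uIter adj (n + 1) B) ⟶[SSet.{v}] Y))
    (hac : a ≫ eHomWhiskerRight SSet (F.map (U.map (iterMap adj.toComonad (n + 1) g))) X =
      ∂Δ[m].ι ≫ c)
    (hab : ∀ i ≤ n, a ≫ eHomWhiskerRight SSet (F.map (unitInsertion adj B n i)) X =
      ∂Δ[m].ι ≫ b i)
    (hae : a ≫ eHomWhiskerLeft SSet _ p = ∂Δ[m].ι ≫ e)
    (hce : c ≫ eHomWhiskerLeft SSet _ p =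
      e ≫ eHomWhiskerRight SSet (F.map (U.map (iterMap adj.toComonad (n + 1) g))) Y)
    (hbe : ∀ i ≤ n, b i ≫ eHomWhiskerLeft SSet _ p =
      e ≫ eHomWhiskerRight SSet (F.map (unitInsertion adj B n i)) Y)
    (hcb : ∀ i ≤ n, c ≫ eHomWhiskerRight SSet (F.map (unitInsertion adj A n i)) X =
      b i ≫ eHomWhiskerRight SSet (F.map (U.map (iterMap adj.toComonad n g))) X)
    (hbb : ∀ (k : ℕ) (hk : k + 1 = n) (i j : ℕ), i ≤ j → j ≤ k →
      b i ≫ eHomWhiskerRight SSet (F.map (unitInsertion adj B k j ≫ eqToHom (by rw [hk]))) X =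
        b (j + 1) ≫
          eHomWhiskerRight SSet (F.map (unitInsertion adj B k i ≫ eqToHom (by rw [hk]))) X) :
    ∃ d : Δ[m] ⟶ (F.obj (uIter adj (n + 1) B) ⟶[SSet.{v}] X), ∂Δ[m].ι ≫ d = a ∧
      d ≫ eHomWhiskerRight SSet (F.map (U.map (iterMap adj.toComonad (n + 1) g))) X = c ∧
      (∀ i ≤ n, d ≫ eHomWhiskerRight SSet (F.map (unitInsertion adj B n i)) X = b i) ∧
      d ≫ eHomWhiskerLeft SSet _ p = e := by
  obtain ⟨f, hfc, hfb⟩ := exists_desc_latching_left hadj hpow n c b hcb hbb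
  have hA (Z : M) :
      eHomWhiskerRight SSet (F.map (latching adj g (n + 1)).hom) Z ≫
          eHomWhiskerRight SSet (F.map (fromSource adj g (n + 1))) Z =
        eHomWhiskerRight SSet (F.map (U.map (iterMap adj.toComonad (n + 1) g))) Z := by
    rw [← eHomWhiskerRight_comp, ← F.map_comp, fromSource_hom]
  have hB (Z : M) (i : ℕ) :
      eHomWhiskerRight SSet (F.map (latching adj g (n + 1)).hom) Z ≫
          eHomWhiskerRight SSet (F.map (fromDegenerate adj g n i)) Z =
        eHomWhiskerRight SSet (F.map (unitInsertion adj B n i)) Z := by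
    rw [← eHomWhiskerRight_comp, ← F.map_comp, fromDegenerate_hom]
  obtain ⟨d, hda, hdf, hde⟩ := hp.of_isSimplicialAdjunction hadj m a f e
    (latching_left_hom_ext hadj hpow n
      (by rw [Category.assoc, Category.assoc, hfc, ← hac]
          exact congrArg (a ≫ ·) (hA X))
      (fun i hi => by
        rw [Category.assoc, Category.assoc, hfb i hi, ← hab i hi]
        exact congrArg (a ≫ ·) (hB X i)))
    hae
    (latching_left_hom_ext hadj hpow n
      (by rw [Category.assoc, Category.assoc, eHom_whisker_exchange, reassoc_of% hfc, hce]
          exact congrArg (e ≫ ·) (hA Y).symm)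
      (fun i hi => by
        rw [Category.assoc, Category.assoc, eHom_whisker_exchange, reassoc_of% hfb i hi, hbe i hi]
        exact congrArg (e ≫ ·) (hB Y i).symm))
  refine ⟨d, hda, ?_, fun i hi => ?_, hde⟩
  · rw [← hfc, ← hdf, Category.assoc]
    exact congrArg (d ≫ ·) (hA X).symm
  · rw [← hfb i hi, ← hdf, Category.assoc]
    exact congrArg (d ≫ ·) (hB X i).symm

end TransposedLifting

/-! ### Degeneracies of the bar construction -/

section Bar

variable {N : Type u₁} [Category.{v} N] {M : Type u₂} [Category.{v} M]
  {F : N ⥤ M} {U : M ⥤ N} (adj : F ⊣ U)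

/-- For `i = 0` the outermost copy of `FU` is comultiplied by `δ = F η U`. For `i + 1` it is left
alone: the `δ` and `ε` introduced by the recursion of `act` cancel by counitality, leaving `FU` of
the case `i`. -/
lemma act_predAbove (X : M) : ∀ (n : ℕ) (i : Fin (n + 1)),
    act adj.toComonad X (n + 2) (n + 1) (Fin.predAboveOrderHom i) =
      F.map (unitInsertion adj X n i)
  | n, ⟨0, hi⟩ => by
    have ht : tail (Fin.predAboveOrderHom (⟨0, hi⟩ : Fin (n + 1))) = OrderHom.id := by
      ext k
      simp [tail]
    rw [act_of_eq _ rfl, ht, act_id, unitInsertion_zero]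
    exact (congrArg (adj.toComonad.δ.app _ ≫ ·) (adj.toComonad.map_id _)).trans
      (Category.comp_id _)
  | n + 1, ⟨i + 1, hi⟩ => by
    have h0 : tail (Fin.predAboveOrderHom (⟨i + 1, hi⟩ : Fin (n + 2))) 0 ≠ 0 :=
      fun h => Fin.succ_ne_zero _ ((Fin.succ_predAbove_succ
        (⟨i, Nat.lt_of_succ_lt_succ hi⟩ : Fin (n + 1)) 0).symm.trans h)
    have hs : shift (tail (Fin.predAboveOrderHom (⟨i + 1, hi⟩ : Fin (n + 2)))) h0 =
        Fin.predAboveOrderHom (⟨i, Nat.lt_of_succ_lt_succ hi⟩ : Fin (n + 1)) := by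
      ext k
      exact congrArg (fun j => j.val - 1)
        (Fin.succ_predAbove_succ (⟨i, Nat.lt_of_succ_lt_succ hi⟩ : Fin (n + 1)) k)
    rw [act_of_eq _ (by simp), act_of_ne _ h0, hs, act_predAbove X n]
    have key {Z Z' : M} (x : Z ⟶ Z') :
        adj.toComonad.δ.app Z ≫ adj.toComonad.map (adj.toComonad.ε.app Z ≫ x) =
          adj.toComonad.map x := by
      exact (congrArg (_ ≫ ·) (adj.toComonad.map_comp _ _)).trans
        (adj.toComonad.right_counit_assoc _ _)
    exact key _

end Bar

/-! ### Maps out of a realization as cosimplicial maps -/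

section MappingOut

variable {M : Type u₂} [Category.{v} M] [SimplicialCategory M]

/-- The cosimplicial simplicial set `n ↦ Map(Z_n, X)` of a simplicial object `Z`. -/
def mapOut (Z : SimplicialObject M) (X : M) : SimplexCategory ⥤ SSet.{v} where
  obj n := Z.obj (op n) ⟶[SSet.{v}] X
  map θ := eHomWhiskerRight SSet (Z.map θ.op) X
  map_id n := by
    rw [op_id]
    exact (congrArg (eHomWhiskerRight SSet · X) (Z.map_id _)).trans (eHomWhiskerRight_id _ _ _)
  map_comp θ θ' := by
    rw [op_comp]
    exact (congrArg (eHomWhiskerRight SSet · X) (Z.map_comp _ _)).trans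
      (eHomWhiskerRight_comp _ _ _ _)

/-- The contravariant functoriality of `mapOut` in the simplicial object. -/
def mapOutPrecomp {Z Z' : SimplicialObject M} (g : Z ⟶ Z') (X : M) : mapOut Z' X ⟶ mapOut Z X where
  app n := eHomWhiskerRight SSet (g.app (op n)) X
  naturality m n θ := by
    refine (eHomWhiskerRight_comp _ _ _ _).symm.trans
      (Eq.trans ?_ (eHomWhiskerRight_comp _ _ _ _))
    exact congrArg (eHomWhiskerRight SSet · X) (g.naturality θ.op).symm

/-- The functoriality of `mapOut` in the object. -/
def mapOutPostcomp (Z : SimplicialObject M) {X Y : M} (p : X ⟶ Y) : mapOut Z X ⟶ mapOut Z Y where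
  app n := eHomWhiskerLeft SSet (Z.obj (op n)) p
  naturality _ _ _ := (eHom_whisker_exchange _ _ _).symm

namespace Realization

variable {Z : SimplicialObject M} (R : Realization Z)

/-- The family of maps `Δ[n] ⟶ Map(Z_n, X)` corresponding to a map from the realization. -/
def homToMapOut {X : M} (f : R.pt ⟶ X) : SSet.stdSimplex.{v} ⟶ mapOut Z X where
  app n := R.ι n ≫ eHomWhiskerLeft SSet (Z.obj (op n)) f
  naturality m n θ := by
    refine (Category.assoc _ _ _).symm.trans ?_
    refine (congrArg (· ≫ _) (R.ι_naturality θ)).trans ((Category.assoc _ _ _).trans ?_)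
    exact (congrArg (R.ι m ≫ ·) (eHom_whisker_exchange SSet (Z.map θ.op) f).symm).trans
      (Category.assoc _ _ _).symm

/-- This is the universal property of the realization at `K` the unit, since maps from the unit into
a simplicial hom-set are ordinary morphisms. -/
lemma homToMapOut_bijective (X : M) :
    Function.Bijective (R.homToMapOut : (R.pt ⟶ X) → _) := by
  have key (f : R.pt ⟶ X) (n : SimplexCategory) :
      (R.ι n ⊗ₘ eHomEquiv SSet.{v} f) ≫ eComp SSet (Z.obj (op n)) R.pt X =
        (ρ_ _).hom ≫ R.ι n ≫ eHomWhiskerLeft SSet (Z.obj (op n)) f := by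
    rw [MonoidalCategory.tensorHom_def, Category.assoc, eHomWhiskerLeft,
      rightUnitor_inv_naturality_assoc, Iso.hom_inv_id_assoc]
  have hψ (ψ : ∀ n, SSet.stdSimplex.{v}.obj n ⟶ (Z.obj (op n) ⟶[SSet.{v}] X))
      (h : ∀ {m n : SimplexCategory} (θ : m ⟶ n), SSet.stdSimplex.map θ ≫ ψ n =
        ψ m ≫ eHomWhiskerRight SSet (Z.map θ.op) X) := R.existsUnique_desc X (𝟙_ _)
    (fun n => (ρ_ _).hom ≫ ψ n) (fun {m n} θ => by
      rw [rightUnitor_naturality_assoc, h, Category.assoc])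
  have h (φ : SSet.stdSimplex.{v} ⟶ mapOut Z X) := hψ φ.app (fun θ => φ.naturality θ)
  constructor
  · intro f f' hf
    refine (eHomEquiv SSet.{v}).injective ((h (R.homToMapOut f')).unique (fun n => ?_)
      (fun n => key f' n))
    rw [key, ← hf]
    rfl
  · intro φ
    obtain ⟨f, hf, -⟩ := h φ
    refine ⟨(eHomEquiv SSet.{v}).symm f, NatTrans.ext (funext fun n => ?_)⟩
    have h := hf n
    rw [← (eHomEquiv SSet.{v}).apply_symm_apply f, key] at h
    exact (cancel_epi (ρ_ _).hom).1 h

end Realization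

end MappingOut

/-! ### The two conditions on a lift -/

section BarTarget

variable {N : Type u₁} [Category.{v} N] {M : Type u₂} [Category.{v} M]
  {F : N ⥤ M} {U : M ⥤ N}

lemma barConstruction_map_σ (adj : F ⊣ U) (Z : M) (n : ℕ) (i : Fin (n + 1)) :
    ((barConstruction adj).obj Z).map (SimplexCategory.σ i).op =
      F.map (unitInsertion adj Z n i) :=
  act_predAbove adj Z n i

variable [SimplicialCategory M]

lemma mapOut_barConstruction_map_σ (adj : F ⊣ U) (Z W : M) (n : ℕ) (i : Fin (n + 1)) :
    (mapOut ((barConstruction adj).obj Z) W).map (SimplexCategory.σ i) =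
      eHomWhiskerRight SSet (F.map (unitInsertion adj Z n i)) W :=
  congrArg (eHomWhiskerRight SSet · W) (barConstruction_map_σ adj Z n i)

/-- Over `g : A ⟶ B` and `p : X ⟶ Y`, the targets of the maps out of `Map(B_•(F, UF, UB), X)`:
`Map(B_•(F, UF, UA), X)` and `Map(B_•(F, UF, UB), Y)`. -/
def barTarget (adj : F ⊣ U) (A B X Y : M) : Bool → (SimplexCategory ⥤ SSet.{v})
  | true => mapOut ((barConstruction adj).obj A) X
  | false => mapOut ((barConstruction adj).obj B) Y

/-- The maps from `Map(B_•(F, UF, UB), X)` induced by `g : A ⟶ B` and `p : X ⟶ Y`. -/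
def toBarTarget (adj : F ⊣ U) (g : A ⟶ B) (p : X ⟶ Y) :
    ∀ t, mapOut ((barConstruction adj).obj B) X ⟶ barTarget adj A B X Y t
  | true => mapOutPrecomp ((barConstruction adj).map g) X
  | false => mapOutPostcomp _ p

end BarTarget

/-! ### The lifting property of the realized map -/

section BarLifting

variable {N : Type u₁} [Category.{v} N] [SimplicialCategory N] [HasPushouts N]
  {M : Type u₂} [Category.{v} M] [SimplicialCategory M]
  {F : N ⥤ M} {U : M ⥤ N} {adj : F ⊣ U} {sF : SimplicialFunctor F} {sU : SimplicialFunctor U}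
  {A B : M} {g : A ⟶ B} {X Y : M} {p : X ⟶ Y}

open Simplicial in
theorem hasMatchingLifts_toBarTarget (hadj : IsSimplicialAdjunction adj sF sU)
    [PreservesColimitsOfShape WalkingSpan (F ⋙ U)]
    (hpow : ∀ (K : SSet.{v}) (X : N), ∃ (P : N) (π : K ⟶ (P ⟶[SSet.{v}] X)), IsPower π)
    (hp : ∀ n, HasBoundaryLifts (latching adj g n).hom (U.map p))
    (ψ : ∀ t, SSet.stdSimplex.{v} ⟶ barTarget adj A B X Y t)
    (hψ : ψ true ≫ mapOutPostcomp _ p = ψ false ≫ mapOutPrecomp ((barConstruction adj).map g) Y) :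
    HasMatchingLifts (toBarTarget adj g p) ψ := by
  intro n a b hbb hab haq hbq
  have hψn := fun n => congrArg (fun φ => φ.app n) hψ
  cases n with
  | zero =>
    -- In degree `0` there are no degeneracies, and the relative latching map is `F (U g)` itself.
    obtain ⟨d, hda, hdc, hde⟩ := (hp 0).of_isSimplicialAdjunction hadj 0 a ((ψ true).app ⦋0⦌)
      ((ψ false).app ⦋0⦌) (haq true) (haq false) (hψn ⦋0⦌)
    exact ⟨d, hda, fun k hk => (Nat.not_lt_zero _ hk).elim, Bool.forall_bool.2 ⟨hde, hdc⟩⟩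
  | succ n =>
    have hv {k i : ℕ} (hi : i ≤ k) : (Fin.ofNat (k + 1) i).val = i :=
      Nat.mod_eq_of_lt (Nat.lt_succ_of_le hi)
    have hσ (Z W : M) {k i : ℕ} (hi : i ≤ k) :
        eHomWhiskerRight SSet (F.map (unitInsertion adj Z k i)) W =
          (mapOut ((barConstruction adj).obj Z) W).map
            (SimplexCategory.σ (Fin.ofNat (k + 1) i)) := by
      rw [mapOut_barConstruction_map_σ, hv hi]
    obtain ⟨d, hda, hdc, hdb, hde⟩ := exists_lift_succ (m := n + 1) hadj hpow (hp (n + 1)) a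
      (fun i => b ⦋n⦌ (Nat.lt_succ_self n) (SimplexCategory.σ (Fin.ofNat (n + 1) i)))
      ((ψ true).app ⦋n + 1⦌) ((ψ false).app ⦋n + 1⦌) (haq true)
      (fun i hi => by
        rw [hσ B X hi]
        exact hab ⦋n⦌ _ _)
      (haq false) (hψn ⦋n + 1⦌)
      (fun i hi => by
        rw [hσ B Y hi]
        exact hbq ⦋n⦌ _ _ false)
      (fun i hi => by
        rw [hσ A X hi]
        exact (hbq ⦋n⦌ _ _ true).symm)
      (fun k hk i j hij hj => by
        subst hk
        have hi : Fin.ofNat (k + 2) i = (Fin.ofNat (k + 1) i).castSucc := by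
          ext
          rw [Fin.val_castSucc, hv (hij.trans hj), hv (by omega)]
        have hj' : Fin.ofNat (k + 2) (j + 1) = (Fin.ofNat (k + 1) j).succ := by
          ext
          rw [Fin.val_succ, hv hj, hv (by omega)]
        rw [eqToHom_refl, Category.comp_id, Category.comp_id, hσ B X hj,
          hσ B X (hij.trans hj)]
        -- Both sides are values of `b` at composites of two codegeneracies, which agree by the
        -- simplicial identity for `i ≤ j`.
        refine (hbb ⦋k + 1⦌ ⦋k⦌ _ (by simp) _ _).trans
          (Eq.trans ?_ (hbb ⦋k + 1⦌ ⦋k⦌ _ (by simp) _ _).symm)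
        rw [hi, hj', SimplexCategory.σ_comp_σ]
        rw [Fin.le_def, hv hj, hv (hij.trans hj)]
        exact hij)
    -- A map to a lower degree is not injective, so it factors through some `σ i`; the matching
    -- condition therefore follows from the codegeneracies alone.
    have hθ (k : SimplexCategory) (hk : k.len < n + 1) (θ : ⦋n + 1⦌ ⟶ k) :
        d ≫ (mapOut ((barConstruction adj).obj B) X).map θ = b k hk θ := by
      obtain ⟨i, θ', rfl⟩ := SimplexCategory.eq_σ_comp_of_not_injective θ (fun h => by
        have := SimplexCategory.mono_iff_injective.2 h
        exact absurd (SimplexCategory.len_le_of_mono θ) (not_le.2 hk))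
      have h := hdb i.val (Nat.lt_succ_iff.1 i.isLt)
      rw [← mapOut_barConstruction_map_σ, Fin.ofNat_val_eq_self] at h
      rw [Functor.map_comp]
      refine (Category.assoc _ _ _).symm.trans ((congrArg (· ≫ _) h).trans ?_)
      exact hbb ⦋n⦌ k _ hk _ θ'
    exact ⟨d, hda, hθ, Bool.forall_bool.2 ⟨hde, hdc⟩⟩

theorem hasLiftingProperty_realization_map (hadj : IsSimplicialAdjunction adj sF sU)
    [PreservesColimitsOfShape WalkingSpan (F ⋙ U)]
    (hpow : ∀ (K : SSet.{v}) (X : N), ∃ (P : N) (π : K ⟶ (P ⟶[SSet.{v}] X)), IsPower π)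
    (hp : ∀ n, HasBoundaryLifts (latching adj g n).hom (U.map p))
    (RA : Realization ((barConstruction adj).obj A))
    (RB : Realization ((barConstruction adj).obj B)) :
    HasLiftingProperty (RA.map RB ((barConstruction adj).map g)) p where
  sq_hasLift {u w} sq := by
    have hpre {Z : M} (f : RB.pt ⟶ Z) :
        RB.homToMapOut f ≫ mapOutPrecomp ((barConstruction adj).map g) Z =
          RA.homToMapOut (RA.map RB ((barConstruction adj).map g) ≫ f) := by
      refine NatTrans.ext (funext fun n => ?_)
      refine (Category.assoc _ _ _).trans ?_
      refine (congrArg (RB.ι n ≫ ·) (eHom_whisker_exchange SSet _ f)).trans ?_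
      refine (Category.assoc _ _ _).symm.trans ?_
      refine (congrArg (· ≫ _) (RA.ι_map RB ((barConstruction adj).map g) n).symm).trans ?_
      refine (Category.assoc _ _ _).trans ?_
      exact congrArg (RA.ι n ≫ ·) (eHomWhiskerLeft_comp _ _ _ _).symm
    have hpost {Z : SimplicialObject M} (R : Realization Z) (f : R.pt ⟶ X) :
        R.homToMapOut f ≫ mapOutPostcomp Z p = R.homToMapOut (f ≫ p) := by
      refine NatTrans.ext (funext fun n => ?_)
      refine (Category.assoc _ _ _).trans ?_
      exact congrArg (R.ι n ≫ ·) (eHomWhiskerLeft_comp _ _ _ _).symm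
    let ψ : ∀ t, SSet.stdSimplex.{v} ⟶ barTarget adj A B X Y t
      | true => RA.homToMapOut u
      | false => RB.homToMapOut w
    obtain ⟨φ, hφ⟩ := exists_lift_of_hasMatchingLifts _ ψ
      -- The compatibility of the two components of `ψ` is the commutativity of the given square,
      -- transported to cosimplicial maps.
      (hasMatchingLifts_toBarTarget hadj hpow hp ψ
        ((hpost RA u).trans (sq.w ▸ (hpre w).symm)))
    obtain ⟨f, rfl⟩ := (RB.homToMapOut_bijective X).2 φ
    exact ⟨⟨f, (RA.homToMapOut_bijective X).1 ((hpre f).symm.trans (hφ true)),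
      (RB.homToMapOut_bijective Y).1 ((hpost RB f).symm.trans (hφ false))⟩⟩

end BarLifting

end SimplicialBar

end

theorem mainTheorem4
    {N : Type u₁} [Category.{v} N] [SimplicialCategory N] [ModelCategory N]
    [SimplicialBar.SimplicialModelCategory N]
    {M : Type u₂} [Category.{v} M] [SimplicialCategory M]
    {F : N ⥤ M} {U : M ⥤ N} (adj : F ⊣ U)
    (sF : SimplicialBar.SimplicialFunctor F) (sU : SimplicialBar.SimplicialFunctor U)
    (hadj : SimplicialBar.IsSimplicialAdjunction adj sF sU)
    (hU : PreservesColimitsOfShape WalkingSpan U)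
    (hT : SimplicialBar.IsQuillenUnitCofibrant adj.toMonad)
    {A B : M} (g : A ⟶ B) (hg : SimplicialBar.uCofibrations U g)
    (RA : SimplicialBar.Realization ((SimplicialBar.barConstruction adj).obj A))
    (RB : SimplicialBar.Realization ((SimplicialBar.barConstruction adj).obj B)) :
    SimplicialBar.projectiveCofibrations U
        (RA.map RB ((SimplicialBar.barConstruction adj).map g)) ∧
      (SimplicialBar.uWeakEquivalences U g →
        SimplicialBar.projectiveAcyclicCofibrations U
          (RA.map RB ((SimplicialBar.barConstruction adj).map g))) := by
  -- `F` preserves pushouts as a left adjoint and `U` by hypothesis, hence so does `T`.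
  have : PreservesColimitsOfShape WalkingSpan F := adj.leftAdjoint_preservesColimits.1
  have : PreservesColimitsOfShape WalkingSpan (F ⋙ U) := comp_preservesColimitsOfShape F U
  have hpow := SimplicialBar.SimplicialModelCategory.exists_power (N := N)
  have hc := SimplicialBar.latching_mem adj g (W := cofibrations N) (fun _ _ i hi => (hT i hi).1) hg
  refine ⟨fun X Y p hp => ?_, fun hw X Y p hp => ?_⟩
  · exact SimplicialBar.hasLiftingProperty_realization_map hadj hpow
      (fun n => SimplicialBar.hasBoundaryLifts (hc n) hp.1 (Or.inr hp.2)) RA RB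
  -- Here the acyclicity required by SM7 comes from the latching maps, whereas in the first case it
  -- comes from `U p`.
  · have hac := SimplicialBar.latching_mem adj g (W := cofibrations N ⊓ weakEquivalences N)
      (fun _ _ i hi => ⟨(hT i hi.1).1, (hT i hi.1).2 hi.2⟩) ⟨hg, hw⟩
    exact SimplicialBar.hasLiftingProperty_realization_map hadj hpow
      (fun n => SimplicialBar.hasBoundaryLifts (hc n) hp (Or.inl (hac n).2)) RA RB
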